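/- **Corollary (SGD-dependent generalization gap under depolarizing noise).** *Model.* Let $D,L,m\ge 1$ and $N,K,\mathcal T\ge 0$ be integers. An $L$-layer data re-uploading QNN on $N$ qubits is the circuit $U(\theta^{(L+1)})\prod_{l=1}^{L}\bigl(U(x)U(\theta^{(l)})\bigr)$ applied to a density matrix $\rho_{in}$ and followed by the measurement of a Hermitian observable $\mathcal M\in\mathbb C^{2^N\times 2^N}$. Every block is a sequence of fixed unitary gates and single-qubit Pauli rotations $e^{-i\varphi P/2}$, $P\in\{X,Y,Z\}$. Each of the $K$ parameters $\theta\in\mathbb R^K$ is the angle of exactly one rotation in the trainable blocks $U(\theta^{(1)}),\dots,U(\theta^{(L+1)})$; each of the $D$ features of $x\in\mathbb R^D$ is the angle of exactly one rotation of the encoding block $U(x)$, which is applied $L$ times. Under noise of level $p\in[0,1]$, after each gate the depolarizing channel $\mathcal N_p(\rho)=(1-p)\rho+p\,\mathrm{tr}(\rho)\,I/2^N$ acts. Let $f(\theta,x)$ be the resulting expectation value of $\mathcal M$, and let $\|\mathcal M\|_\infty$ be the spectral norm. *Loss.* For every label $y$ in a set $\mathcal Y\subseteq\mathbb R$ and all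 $a,b\in[-\|\mathcal M\|_\infty,\|\mathcal M\|_\infty]$, the measurable loss $\ell$ satisfies $0\le\ell(a,y)\le M$, is differentiable in $a$, and $|\ell(a,y)-\ell(b,y)|\le \mathcal C_1|a-b|$, $|\partial_a\ell(a,y)-\partial_a\ell(b,y)|\le \mathcal C_2|a-b|$. *Algorithm.* Let $S=((x_i,y_i))_{i=1}^m$ be drawn i.i.d. from a probability distribution $\mathbb D$ on $\mathbb R^D\times\mathbb R$ whose labels lie in $\mathcal Y$ almost surely. From an initial $\theta_0\in\mathbb R^K$, drawn from any distribution independently of everything else, $\mathcal A_S$ performs $\mathcal T$ SGD steps $\theta_{t+1}=\theta_t-\eta\nabla_\theta\,\ell(f(\theta_t,x_{i_t}),y_{i_t})$ with learning rate $\eta>0$, the indices $i_t$ being independent and uniform on $\{1,\dots,m\}$. Write $R(\mathcal A_S)=\mathbb E_{(x,y)\sim\mathbb D}[\ell(f(\theta_{\mathcal T},x),y)]$ and $\hat R(\mathcal A_S)=\frac1m\sum_{i=1}^m\ell(f(\theta_{\mathcal T},x_i),y_i)$, and let $\mathbb E_{\rm SGD}$ be the expectation over $\theta_0$ and the indices.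 *Claim.* For all $\mathcal C_1,\mathcal C_2\ge0$ there are functions $g_{\mathcal T}$, $\mathcal T=0,1,2,\dots$, depending only on $\mathcal C_1,\mathcal C_2,\mathcal T$, nondecreasing on $[0,\infty)$, with $g_{\mathcal T}(b)=\mathcal O(b^{\mathcal T})$ as $b\to\infty$, and more precisely $|g_{\mathcal T}(b)|\le (c\,b)^{\mathcal T}$ for all $b\ge1$ and all $\mathcal T$ with a constant $c=c(\mathcal C_1,\mathcal C_2)>0$, such that in every situation as above and for every $\delta\in(0,1)$, with probability at least $1-\delta$ over the draw of $S$, $$\mathbb E_{\rm SGD}[R(\mathcal A_S)-\hat R(\mathcal A_S)]\le \frac{(1-p)^{LD}LD\|\mathcal M\|_\infty}{m}\,g_{\mathcal T}\!\left(\eta(1-p)^{K}K\|\mathcal M\|_\infty\right)+\left((1-p)^{LD}LD\|\mathcal M\|_\infty\; g_{\mathcal T}\!\left(\eta(1-p)^{K}K\|\mathcal M\|_\infty\right)+M\right)\sqrt{\frac{\log\frac1\delta}{2m}} .$$ -/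

import Mathlib

open MeasureTheory
open scoped ComplexOrder

noncomputable section

namespace NoisyQNN

/-- Computational basis of a register of `N` qubits (so its Hilbert space has dimension `2 ^ N`). -/
abbrev Basis (N : ℕ) : Type := Fin N → Fin 2

/-- Operators on a register of `N` qubits. -/
abbrev Op (N : ℕ) : Type := Matrix (Basis N) (Basis N) ℂ

/-- The three Pauli labels. -/
inductive Pauli : Type
  | X
  | Y
  | Z

/-- The Pauli matrices. -/
def Pauli.toMatrix : Pauli → Matrix (Fin 2) (Fin 2) ℂ
  | .X => !![0, 1; 1, 0]
  | .Y => !![0, -Complex.I; Complex.I, 0]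
  | .Z => !![1, 0; 0, -1]

/-- The single-qubit operator `A` acting on qubit `q`, tensored with the identity on all other
qubits. -/
def onQubit {N : ℕ} (q : Fin N) (A : Matrix (Fin 2) (Fin 2) ℂ) : Op N :=
  Matrix.of fun s t => if ∀ r, r ≠ q → s r = t r then A (s q) (t q) else 0

/-- The Pauli rotation `exp (-i φ P / 2)` on qubit `q`. -/
def pauliRotation {N : ℕ} (P : Pauli) (q : Fin N) (φ : ℝ) : Op N :=
  NormedSpace.exp ((-(Complex.I * (φ : ℂ) / 2)) • onQubit q P.toMatrix)

/-- A gate on `N` qubits: either a fixed unitary, or a single-qubit Pauli rotation whose angle is the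
coordinate `i` of an angle vector indexed by `ι`. -/
inductive Gate (N : ℕ) (ι : Type) : Type
  | fixed (V : Matrix.unitaryGroup (Basis N) ℂ) : Gate N ι
  | rotation (i : ι) (P : Pauli) (q : Fin N) : Gate N ι

/-- The unitary implemented by a gate at the angle vector `v`. -/
def Gate.toOp {N : ℕ} {ι : Type} (v : ι → ℝ) : Gate N ι → Op N
  | .fixed V => (V : Op N)
  | .rotation i P q => pauliRotation P q (v i)

/-- The coordinate of the angle vector that a gate uses, if any. -/
def Gate.coord? {N : ℕ} {ι : Type} : Gate N ι → Option ι
  | .fixed _ => none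
  | .rotation i _ _ => some i

/-- The depolarizing channel `ρ ↦ (1 - p) ρ + p tr(ρ) I / 2 ^ N`: with probability `1 - p` the state
is unchanged, with probability `p` it is replaced by the maximally mixed state. -/
def depolarize {N : ℕ} (p : ℝ) (ρ : Op N) : Op N :=
  ((1 - p : ℝ) : ℂ) • ρ + ((p : ℂ) * ρ.trace / 2 ^ N) • (1 : Op N)

/-- The spectral norm (Schatten norm of order infinity) of an operator. -/
def opNorm {N : ℕ} (A : Op N) : ℝ := ‖Matrix.toEuclideanCLM (𝕜 := ℂ) A‖

/-- A data re-uploading quantum neural network on `N` qubits with `K` trainable parameters, data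
dimension `D` and `L` layers. Gates in a list act from left to right. -/
structure DataReuploadingQNN (N K D L : ℕ) where
  /-- the trainable blocks `U(θ⁽¹⁾), …, U(θ⁽ᴸ⁺¹⁾)` -/
  trainable : Fin (L + 1) → List (Gate N (Fin K))
  /-- the data-encoding block `U(x)`, which is applied `L` times -/
  encoding : List (Gate N (Fin D))
  /-- the input state -/
  ρin : Op N
  /-- the measured observable -/
  obs : Op N
  /-- each of the `K` trainable parameters is the angle of exactly one rotation gate -/
  trainable_perm :
    ((List.ofFn trainable).flatten.filterMap Gate.coord?).Perm (List.finRange K)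
  /-- each of the `D` features is the angle of exactly one rotation gate of the encoding block -/
  encoding_perm : (encoding.filterMap Gate.coord?).Perm (List.finRange D)
  ρin_posSemidef : ρin.PosSemidef
  ρin_trace : ρin.trace = 1
  obs_hermitian : obs.IsHermitian

namespace DataReuploadingQNN

variable {N K D L : ℕ}

/-- The unitaries of all gates of the circuit
`U(θ⁽ᴸ⁺¹⁾) U(x) U(θ⁽ᴸ⁾) ⋯ U(θ⁽²⁾) U(x) U(θ⁽¹⁾)`, in the order in which they are applied. -/
def gates (Q : DataReuploadingQNN N K D L) (θ : Fin K → ℝ) (x : Fin D → ℝ) : List (Op N) :=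
  (Q.trainable 0).map (Gate.toOp θ) ++
    (List.ofFn fun l : Fin L =>
      Q.encoding.map (Gate.toOp x) ++ (Q.trainable l.succ).map (Gate.toOp θ)).flatten

/-- The state at the end of the circuit, when each gate is followed by depolarizing noise of
level `p`. -/
def outputState (Q : DataReuploadingQNN N K D L) (p : ℝ) (θ : Fin K → ℝ) (x : Fin D → ℝ) : Op N :=
  (Q.gates θ x).foldl (fun ρ U => depolarize p (U * ρ * U.conjTranspose)) Q.ρin

/-- The output function `f(θ, x)` of the noisy network: the expectation value of the observable. -/
def output (Q : DataReuploadingQNN N K D L) (p : ℝ) (θ : Fin K → ℝ) (x : Fin D → ℝ) : ℝ :=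
  ((Q.outputState p θ x * Q.obs).trace).re

/-- One step of stochastic gradient descent with learning rate `η`, on the sample `z = (x, y)`:
`θ⁽ʲ⁾ ↦ θ⁽ʲ⁾ - η ∂ℓ(f(θ, x), y)/∂θ⁽ʲ⁾` for every `j`. -/
def sgdStep (Q : DataReuploadingQNN N K D L) (p : ℝ) (ℓ : ℝ → ℝ → ℝ) (η : ℝ)
    (z : (Fin D → ℝ) × ℝ) (θ : Fin K → ℝ) : Fin K → ℝ :=
  fun j => θ j - η * deriv (fun u => ℓ (Q.output p (Function.update θ j u) z.1) z.2) (θ j)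

/-- The parameters after `T` steps from `θ₀` on the training set `S`, where step `t` uses the sample
with index `ω t`. -/
def sgd (Q : DataReuploadingQNN N K D L) (p : ℝ) (ℓ : ℝ → ℝ → ℝ) (η : ℝ) {m T : ℕ}
    (S : Fin m → (Fin D → ℝ) × ℝ) (ω : Fin T → Fin m) (θ₀ : Fin K → ℝ) : Fin K → ℝ :=
  (List.ofFn ω).foldl (fun θ i => Q.sgdStep p ℓ η (S i) θ) θ₀

/-- The expected risk at `θ` for the data distribution `𝔻`. -/
def risk (Q : DataReuploadingQNN N K D L) (p : ℝ) (ℓ : ℝ → ℝ → ℝ)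
    (𝔻 : Measure ((Fin D → ℝ) × ℝ)) (θ : Fin K → ℝ) : ℝ :=
  ∫ z, ℓ (Q.output p θ z.1) z.2 ∂𝔻

/-- The empirical risk at `θ` on the training set `S`. -/
def empiricalRisk (Q : DataReuploadingQNN N K D L) (p : ℝ) (ℓ : ℝ → ℝ → ℝ) {m : ℕ}
    (S : Fin m → (Fin D → ℝ) × ℝ) (θ : Fin K → ℝ) : ℝ :=
  (∑ i, ℓ (Q.output p θ (S i).1) (S i).2) / m

/-- The expectation over the randomness of `T`-step stochastic gradient descent on `S` of a function
`F` of the learned parameters: the initial parameters are drawn from `ν`, and the sample index of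
each step is uniform on `Fin m`, independently of everything else. -/
def sgdExpectation (Q : DataReuploadingQNN N K D L) (p : ℝ) (ℓ : ℝ → ℝ → ℝ) (η : ℝ) {m : ℕ} (T : ℕ)
    (ν : Measure (Fin K → ℝ)) (S : Fin m → (Fin D → ℝ) × ℝ) (F : (Fin K → ℝ) → ℝ) : ℝ :=
  ∫ θ₀, (∑ ω : Fin T → Fin m, F (Q.sgd p ℓ η S ω θ₀)) / (m : ℝ) ^ T ∂ν

/-- The expected generalization gap `𝔼_SGD[R(A_S) - R̂_S(A_S)]`. -/
def expectedGap (Q : DataReuploadingQNN N K D L) (p : ℝ) (ℓ : ℝ → ℝ → ℝ) (η : ℝ) {m : ℕ} (T : ℕ)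
    (ν : Measure (Fin K → ℝ)) (𝔻 : Measure ((Fin D → ℝ) × ℝ))
    (S : Fin m → (Fin D → ℝ) × ℝ) : ℝ :=
  Q.sgdExpectation p ℓ η T ν S fun θ => Q.risk p ℓ 𝔻 θ - Q.empiricalRisk p ℓ S θ

end DataReuploadingQNN

/-- The loss `ℓ(a, y)` is, for labels `y ∈ 𝒴` and predictions `|a| ≤ B`, Lipschitz continuous with
constant `C₁` and smooth with constant `C₂` in the prediction. -/
structure IsLipschitzSmooth (ℓ : ℝ → ℝ → ℝ) (𝒴 : Set ℝ) (B C₁ C₂ : ℝ) : Prop where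
  lipschitz : ∀ y ∈ 𝒴, ∀ a ∈ Set.Icc (-B) B, ∀ b ∈ Set.Icc (-B) B,
    |ℓ a y - ℓ b y| ≤ C₁ * |a - b|
  differentiable : ∀ y ∈ 𝒴, ∀ a ∈ Set.Icc (-B) B, DifferentiableAt ℝ (fun u => ℓ u y) a
  smooth : ∀ y ∈ 𝒴, ∀ a ∈ Set.Icc (-B) B, ∀ b ∈ Set.Icc (-B) B,
    |deriv (fun u => ℓ u y) a - deriv (fun u => ℓ u y) b| ≤ C₂ * |a - b|

/-- `g T b` is `O(b ^ T)` for growing `b`, with a constant of the form `c ^ T`, and is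
nondecreasing in `b ≥ 0` (so that it is at most `c ^ T` for `b ≤ 1`). -/
def IsBigOPow (g : ℕ → ℝ → ℝ) : Prop :=
  (∀ T, MonotoneOn (g T) (Set.Ici 0)) ∧
    ∃ c : ℝ, 0 < c ∧ ∀ (T : ℕ) (b : ℝ), 1 ≤ b → |g T b| ≤ (c * b) ^ T

end NoisyQNN

end

/-!
Depolarizing noise commutes with unitary gates, so a circuit of `n` gates outputs `(1 - p) ^ n`
times the noiseless signal plus a constant; here `n ≥ L * D + K`. As a function of one parameter the
noiseless signal is a trigonometric polynomial of degree one bounded by `‖𝓜‖`, so by the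
parameter-shift rule the loss is Lipschitz in each parameter, with a constant `κ` carrying the
damping factor. Two runs of SGD on training sets that differ in one sample coincide unless that
sample is drawn, which has probability at most `T / m`; otherwise each parameter has moved by at
most `T * η * κ` in either run. Hence SGD is uniformly stable, and McDiarmid's inequality for the
generalization gap, whose mean is bounded by the stability constant, gives the claim.
-/

open ProbabilityTheory
open scoped NNReal

section Concentration

theorem abs_sub_le_sum_of_update {ι : Type*} [Fintype ι] [DecidableEq ι] {X : ι → Type*}
    {F : (∀ i, X i) → ℝ} {d : ∀ i, X i → X i → ℝ}
    (hF : ∀ x i a, |F (Function.update x i a) - F x| ≤ d i a (x i)) (x y : ∀ i, X i) :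
    |F x - F y| ≤ ∑ i, d i (x i) (y i) := by
  have partialSum : ∀ s : Finset ι, |F (s.piecewise x y) - F y| ≤ ∑ i ∈ s, d i (x i) (y i) := by
    intro s
    induction s using Finset.induction_on with
    | empty => simp
    | insert i s hi ih =>
      rw [Finset.piecewise_insert, Finset.sum_insert hi]
      refine (abs_sub_le _ (F (s.piecewise x y)) _).trans (add_le_add ?_ ih)
      simpa only [Finset.piecewise_eq_of_notMem _ _ _ hi] using hF (s.piecewise x y) i (x i)
  simpa using partialSum Finset.univ

theorem hasSubgaussianMGF_of_forall_abs_sub_le {Ω : Type*} [MeasurableSpace Ω] {μ : Measure Ω}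
    [IsProbabilityMeasure μ] {f : Ω → ℝ} (hf : Measurable f) {c : ℝ≥0}
    (hc : ∀ x y, |f x - f y| ≤ c) :
    HasSubgaussianMGF (fun x => f x - ∫ y, f y ∂μ) ((c / 2) ^ 2) μ := by
  have : Nonempty Ω := nonempty_of_isProbabilityMeasure μ
  have hbdd : BddBelow (Set.range f) := by
    obtain ⟨y⟩ := this
    refine ⟨f y - c, ?_⟩
    rintro _ ⟨x, rfl⟩
    linarith [(abs_le.1 (hc x y)).1]
  have hmem : ∀ x, f x ∈ Set.Icc (⨅ y, f y) ((⨅ y, f y) + c) := fun x =>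
    ⟨ciInf_le hbdd x, sub_le_iff_le_add.1 (le_ciInf fun y => by
      linarith [(abs_le.1 (hc x y)).2])⟩
  simpa using hasSubgaussianMGF_of_mem_Icc hf.aemeasurable (ae_of_all μ hmem)

theorem hasSubgaussianMGF_prod {α β : Type*} [MeasurableSpace α] [MeasurableSpace β]
    {μ : Measure α} {ν : Measure β} [SFinite μ] [SFinite ν] {f : α × β → ℝ} (hf : Measurable f)
    {g : α → ℝ} {c d : ℝ≥0} (hg : HasSubgaussianMGF g c μ)
    (hfg : ∀ a, HasSubgaussianMGF (fun b => f (a, b) - g a) d ν) :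
    HasSubgaussianMGF f (c + d) (μ.prod ν) := by
  have factor : ∀ t a b, Real.exp (t * f (a, b))
      = Real.exp (t * g a) * Real.exp (t * (f (a, b) - g a)) := fun t a b => by
    rw [← Real.exp_add]; ring_nf
  have fiber : ∀ t a, ∫ b, Real.exp (t * f (a, b)) ∂ν
      ≤ Real.exp (t * g a) * Real.exp (d * t ^ 2 / 2) := fun t a => by
    simp_rw [factor, integral_const_mul]
    exact mul_le_mul_of_nonneg_left ((hfg a).mgf_le t) (Real.exp_pos _).le
  have hmeas : ∀ t, AEStronglyMeasurable (fun q => Real.exp (t * f q)) (μ.prod ν) := fun t =>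
    (by fun_prop : Measurable fun q => Real.exp (t * f q)).aestronglyMeasurable
  have hint : ∀ t, Integrable (fun q => Real.exp (t * f q)) (μ.prod ν) := by
    refine fun t => (integrable_prod_iff (hmeas t)).2 ⟨ae_of_all _ fun a => ?_, ?_⟩
    · simp_rw [factor]
      exact ((hfg a).integrable_exp_mul t).const_mul _
    · simp_rw [Real.norm_eq_abs, Real.abs_exp]
      refine ((hg.integrable_exp_mul t).mul_const (Real.exp (d * t ^ 2 / 2))).mono'
        (hmeas t).integral_prod_right' (ae_of_all _ fun a => ?_)
      rw [Real.norm_of_nonneg (integral_nonneg fun b => (Real.exp_pos _).le)]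
      exact fiber t a
  refine ⟨hint, fun t => ?_⟩
  calc mgf f (μ.prod ν) t = ∫ a, ∫ b, Real.exp (t * f (a, b)) ∂ν ∂μ := integral_prod _ (hint t)
    _ ≤ ∫ a, Real.exp (t * g a) * Real.exp (d * t ^ 2 / 2) ∂μ :=
        integral_mono (hint t).integral_prod_left ((hg.integrable_exp_mul t).mul_const _) (fiber t)
    _ ≤ Real.exp (c * t ^ 2 / 2) * Real.exp (d * t ^ 2 / 2) := by
        rw [integral_mul_const]
        exact mul_le_mul_of_nonneg_right (hg.mgf_le t) (Real.exp_pos _).le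
    _ = Real.exp ((c + d : ℝ≥0) * t ^ 2 / 2) := by
        rw [← Real.exp_add, NNReal.coe_add]; ring_nf

theorem measurable_finCons {n : ℕ} {X : Fin (n + 1) → Type*} [∀ i, MeasurableSpace (X i)] :
    Measurable fun q : X 0 × (∀ i : Fin n, X i.succ) => (Fin.cons q.1 q.2 : ∀ i, X i) :=
  measurable_pi_iff.2
    (Fin.cases measurable_fst fun i => (measurable_pi_apply i).comp measurable_snd)

theorem measurePreserving_finCons {n : ℕ} {X : Fin (n + 1) → Type*} [∀ i, MeasurableSpace (X i)]
    (μ : ∀ i, Measure (X i)) [∀ i, SigmaFinite (μ i)] :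
    MeasurePreserving (fun q : X 0 × (∀ i : Fin n, X i.succ) => (Fin.cons q.1 q.2 : ∀ i, X i))
      ((μ 0).prod (Measure.pi fun i => μ i.succ)) (Measure.pi μ) := by
  have hcons : ⇑(MeasurableEquiv.piFinSuccAbove X 0).symm
      = fun q : X 0 × (∀ i : Fin n, X i.succ) => (Fin.cons q.1 q.2 : ∀ i, X i) :=
    funext fun q => funext fun i => Fin.cases (by rfl) (fun i => by rfl) i
  exact hcons ▸ (measurePreserving_piFinSuccAbove μ 0).symm

/-- The hypothesis of McDiarmid's inequality: changing the `i`-th argument of `F` changes its value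
by at most `c i`. -/
def HasBoundedDifferences {ι : Type*} [DecidableEq ι] {X : ι → Type*} (F : (∀ i, X i) → ℝ)
    (c : ι → ℝ≥0) : Prop :=
  ∀ x i a, |F (Function.update x i a) - F x| ≤ c i

namespace HasBoundedDifferences

theorem abs_sub_le {ι : Type*} [Fintype ι] [DecidableEq ι] {X : ι → Type*} {F : (∀ i, X i) → ℝ}
    {c : ι → ℝ≥0} (hF : HasBoundedDifferences F c) (x y : ∀ i, X i) :
    |F x - F y| ≤ ∑ i, (c i : ℝ) :=
  abs_sub_le_sum_of_update (d := fun i _ _ => c i) hF x y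

theorem integrable {ι : Type*} [Finite ι] [DecidableEq ι] {X : ι → Type*}
    [∀ i, MeasurableSpace (X i)] {F : (∀ i, X i) → ℝ} {c : ι → ℝ≥0}
    (hF : HasBoundedDifferences F c) (hFm : Measurable F) (μ : Measure (∀ i, X i))
    [IsFiniteMeasure μ] : Integrable F μ := by
  have := Fintype.ofFinite ι
  rcases isEmpty_or_nonempty (∀ i, X i) with _ | ⟨⟨y⟩⟩
  · exact Integrable.of_isEmpty
  refine Integrable.of_bound hFm.aestronglyMeasurable (|F y| + ∑ i, (c i : ℝ))
    (ae_of_all _ fun x => ?_)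
  rw [Real.norm_eq_abs, ← sub_le_iff_le_add']
  exact (abs_sub_abs_le_abs_sub _ _).trans (hF.abs_sub_le x y)

section Fin

variable {n : ℕ} {X : Fin (n + 1) → Type*} {F : (∀ i, X i) → ℝ} {c : Fin (n + 1) → ℝ≥0}

theorem comp_cons (hF : HasBoundedDifferences F c) (a : X 0) :
    HasBoundedDifferences (fun x : ∀ i : Fin n, X i.succ => F (Fin.cons a x))
      fun i => c i.succ := fun x i b => by
  simpa only [Fin.cons_update] using hF (Fin.cons a x) i.succ b

theorem abs_integral_cons_sub_le [∀ i, MeasurableSpace (X i)] (hF : HasBoundedDifferences F c)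
    (hFm : Measurable F) (μ : Measure (∀ i : Fin n, X i.succ)) [IsProbabilityMeasure μ]
    (a b : X 0) :
    |∫ x, F (Fin.cons a x) ∂μ - ∫ x, F (Fin.cons b x) ∂μ| ≤ c 0 := by
  have hcons : ∀ a, Measurable fun x : ∀ i : Fin n, X i.succ => F (Fin.cons a x) := fun a =>
    hFm.comp (measurable_finCons.comp measurable_prodMk_left)
  rw [← integral_sub ((hF.comp_cons a).integrable (hcons a) μ)
    ((hF.comp_cons b).integrable (hcons b) μ)]
  rw [← Real.norm_eq_abs, ← mul_one (c 0 : ℝ), ← probReal_univ (μ := μ)]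
  refine norm_integral_le_of_norm_le_const (ae_of_all μ fun x => ?_)
  simpa only [Fin.update_cons_zero, Real.norm_eq_abs] using hF (Fin.cons b x) 0 a

end Fin

/-- **McDiarmid's inequality**, as a bound on the moment generating function: condition on the
first coordinate and add up the Hoeffding constants. -/
theorem hasSubgaussianMGF {n : ℕ} {X : Fin n → Type*} [∀ i, MeasurableSpace (X i)]
    (μ : ∀ i, Measure (X i)) [∀ i, IsProbabilityMeasure (μ i)] {F : (∀ i, X i) → ℝ}
    (hFm : Measurable F) {c : Fin n → ℝ≥0} (hF : HasBoundedDifferences F c) :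
    HasSubgaussianMGF (fun x => F x - ∫ y, F y ∂Measure.pi μ) (∑ i, (c i / 2) ^ 2)
      (Measure.pi μ) := by
  induction n with
  | zero =>
    have hconst : ∀ x, F x = F finZeroElim := fun x => congrArg F (Subsingleton.elim _ _)
    simp [hconst]
  | succ n ih =>
    have hcons := measurePreserving_finCons μ
    set π := Measure.pi fun j : Fin n => μ j.succ
    have hFcons : Measurable fun q : X 0 × (∀ j : Fin n, X j.succ) => F (Fin.cons q.1 q.2) :=
      hFm.comp hcons.measurable
    have hmean : ∫ y, F y ∂Measure.pi μ = ∫ a, ∫ x, F (Fin.cons a x) ∂π ∂μ 0 := by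
      rw [← hcons.map_eq, integral_map hcons.measurable.aemeasurable hFm.aestronglyMeasurable,
        integral_prod]
      exact hcons.integrable_comp_of_integrable (hF.integrable hFm _)
    have hfst : HasSubgaussianMGF
        (fun a => ∫ x, F (Fin.cons a x) ∂π - ∫ y, F y ∂Measure.pi μ) ((c 0 / 2) ^ 2) (μ 0) := by
      rw [hmean]
      exact hasSubgaussianMGF_of_forall_abs_sub_le
        hFcons.stronglyMeasurable.integral_prod_right'.measurable
        (hF.abs_integral_cons_sub_le hFm π)
    have hprod := hasSubgaussianMGF_prod (ν := π)
      (hFcons.sub_const (∫ y, F y ∂Measure.pi μ)) hfst fun a => by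
      simpa only [sub_sub_sub_cancel_right, Function.comp_def] using
        ih (fun j => μ j.succ) (hFcons.comp measurable_prodMk_left) (hF.comp_cons a)
    rw [Fin.sum_univ_succ, ← HasSubgaussianMGF.id_map_iff (hFm.sub_const _).aemeasurable,
      ← hcons.map_eq, Measure.map_map (hFm.sub_const _) hcons.measurable,
      HasSubgaussianMGF.id_map_iff ((hFm.sub_const _).comp hcons.measurable).aemeasurable,
      hcons.map_eq]
    exact hprod

end HasBoundedDifferences

theorem measure_le_sqrt_of_hasSubgaussianMGF {Ω : Type*} [MeasurableSpace Ω] {μ : Measure Ω}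
    [IsProbabilityMeasure μ] {X : Ω → ℝ} {c : ℝ≥0} (hX : HasSubgaussianMGF X c μ) {δ : ℝ}
    (hδ : δ ∈ Set.Ioo (0 : ℝ) 1) :
    ENNReal.ofReal (1 - δ) ≤ μ {x | X x ≤ √(2 * c * Real.log (1 / δ))} := by
  have hlog : 0 ≤ Real.log (1 / δ) := Real.log_nonneg (by rw [le_div_iff₀ hδ.1]; linarith [hδ.2])
  have htail : μ {x | √(2 * c * Real.log (1 / δ)) < X x} ≤ ENNReal.ofReal δ := by
    rcases eq_or_ne c 0 with rfl | hc
    · refine (measure_eq_zero_iff_ae_notMem.2 ?_).trans_le zero_le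
      filter_upwards [hX.ae_eq_zero_of_hasSubgaussianMGF_zero] with x hx
      simp [hx]
    have : (0 : ℝ) < c := by positivity
    rw [← ofReal_measureReal]
    refine ENNReal.ofReal_le_ofReal ?_
    calc μ.real {x | √(2 * c * Real.log (1 / δ)) < X x}
        ≤ μ.real {x | √(2 * c * Real.log (1 / δ)) ≤ X x} :=
          measureReal_mono (Set.ofPred_subset_ofPred.2 fun _ => le_of_lt)
      _ ≤ Real.exp (-√(2 * c * Real.log (1 / δ)) ^ 2 / (2 * c)) :=
          hX.measure_ge_le (Real.sqrt_nonneg _)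
      _ = δ := by
          rw [Real.sq_sqrt (by positivity), neg_div, mul_div_cancel_left₀ _ (by positivity),
            one_div, Real.log_inv, neg_neg, Real.exp_log hδ.1]
  have hcompl : {x | X x ≤ √(2 * c * Real.log (1 / δ))}
      = {x | √(2 * c * Real.log (1 / δ)) < X x}ᶜ := by ext; simp
  rw [hcompl, prob_compl_eq_one_sub₀ (nullMeasurableSet_lt aemeasurable_const hX.aemeasurable),
    ENNReal.ofReal_sub _ hδ.1.le, ENNReal.ofReal_one]
  exact tsub_le_tsub_left htail 1

end Concentration

section UniformStability

variable {Z : Type*} {m : ℕ}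

/-- Uniform stability of a learning rule, given through the loss `H S z` at the point `z` of the
hypothesis learned from the training set `S`: replacing one training point changes the loss at any
point by at most `β`. -/
def UniformlyStable (H : (Fin m → Z) → Z → ℝ) (β : ℝ≥0) : Prop :=
  ∀ S i w z, |H (Function.update S i w) z - H S z| ≤ β

/-- The generalization gap of the learning rule with loss `H` (see `UniformlyStable`) on the
training set `S`: expected minus empirical risk. -/
noncomputable def generalizationGap [MeasurableSpace Z] (𝔻 : Measure Z)
    (H : (Fin m → Z) → Z → ℝ) (S : Fin m → Z) : ℝ :=
  ∫ z, H S z ∂𝔻 - (∑ i, H S (S i)) / m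

theorem measurePreserving_update_apply [MeasurableSpace Z] (𝔻 : Measure Z) [SigmaFinite 𝔻]
    (i : Fin m) :
    MeasurePreserving (fun q : (Fin m → Z) × Z => (Function.update q.1 i q.2, q.1 i))
      ((Measure.pi fun _ => 𝔻).prod 𝔻) ((Measure.pi fun _ => 𝔻).prod 𝔻) := by
  obtain ⟨n, rfl⟩ := Nat.exists_eq_succ_of_ne_zero i.pos.ne'
  have split := measurePreserving_piFinSuccAbove (fun _ : Fin (n + 1) => 𝔻) i
  have exchange : MeasurePreserving (fun q : (Z × (Fin n → Z)) × Z => ((q.2, q.1.2), q.1.1)) _ _ :=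
    (Measure.measurePreserving_swap.prod (MeasurePreserving.id 𝔻)).comp
      (Measure.measurePreserving_swap.comp
        (measurePreserving_prodAssoc 𝔻 (Measure.pi fun _ : Fin n => 𝔻) 𝔻))
  convert! (split.symm.prod (.id 𝔻)).comp (exchange.comp (split.prod (.id 𝔻))) using 1
  exact funext fun q => Prod.ext (i.insertNth_removeNth q.2 q.1).symm rfl

variable {H : (Fin m → Z) → Z → ℝ} {β M : ℝ≥0}

namespace UniformlyStable

theorem abs_sum_update_sub_sum_le (hH : UniformlyStable H β)
    (hM : ∀ S z, H S z ∈ Set.Icc (0 : ℝ) M) (S : Fin m → Z) (i : Fin m) (w : Z) :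
    |∑ k, H (Function.update S i w) (Function.update S i w k) - ∑ k, H S (S k)|
      ≤ m * β + M := by
  have hterm : ∀ k, |H (Function.update S i w) (Function.update S i w k) - H S (S k)|
      ≤ β + if k = i then (M : ℝ) else 0 := by
    intro k
    split_ifs with hki
    · have hdiff := abs_sub_le_of_nonneg_of_le (hM (Function.update S i w) _).1
        (hM (Function.update S i w) (Function.update S i w k)).2 (hM S (S k)).1 (hM S (S k)).2
      exact hdiff.trans (le_add_of_nonneg_left β.2)
    · rw [Function.update_of_ne hki, add_zero]
      exact hH S i w (S k)
  rw [← Finset.sum_sub_distrib]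
  calc _ ≤ ∑ k, (β + if k = i then (M : ℝ) else 0) :=
        (Finset.abs_sum_le_sum_abs _ _).trans (Finset.sum_le_sum fun k _ => hterm k)
    _ = m * β + M := by simp [Finset.sum_add_distrib]

variable [MeasurableSpace Z] {𝔻 : Measure Z} [IsProbabilityMeasure 𝔻]

/-- Exchanging the `i`-th training point with an independent test point preserves the joint
distribution, and turns a training error into a test error at the cost of `β`. -/
theorem integral_integral_le (hH : UniformlyStable H β)
    (hHint : Integrable (Function.uncurry H) ((Measure.pi fun _ => 𝔻).prod 𝔻)) (i : Fin m)
    (hHi : Integrable (fun S => H S (S i)) (Measure.pi fun _ => 𝔻)) :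
    ∫ S, ∫ z, H S z ∂𝔻 ∂(Measure.pi fun _ => 𝔻) ≤ ∫ S, H S (S i) ∂(Measure.pi fun _ => 𝔻) + β := by
  set P := Measure.pi fun _ : Fin m => 𝔻
  have exchange := measurePreserving_update_apply 𝔻 i
  calc ∫ S, ∫ z, H S z ∂𝔻 ∂P = ∫ q, Function.uncurry H q ∂P.prod 𝔻 := (integral_prod _ hHint).symm
    _ = ∫ q, H (Function.update q.1 i q.2) (q.1 i) ∂P.prod 𝔻 := by
        conv_lhs => rw [← exchange.map_eq]
        exact integral_map exchange.measurable.aemeasurable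
          (exchange.map_eq.symm ▸ hHint.aestronglyMeasurable)
    _ ≤ ∫ q, (H q.1 (q.1 i) + β) ∂P.prod 𝔻 :=
        integral_mono (exchange.integrable_comp_of_integrable hHint)
          ((hHi.comp_fst 𝔻).add (integrable_const _))
          fun q => sub_le_iff_le_add'.1 (abs_le.1 (hH q.1 i q.2 (q.1 i))).2
    _ = ∫ S, H S (S i) ∂P + β := by
        rw [integral_add (hHi.comp_fst 𝔻) (integrable_const _), integral_const, probReal_univ,
          one_smul, integral_fun_fst fun S => H S (S i), probReal_univ, one_smul]

theorem integral_generalizationGap_le (hH : UniformlyStable H β) (hm : 0 < m)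
    (hHint : Integrable (Function.uncurry H) ((Measure.pi fun _ => 𝔻).prod 𝔻))
    (hHi : ∀ i, Integrable (fun S => H S (S i)) (Measure.pi fun _ => 𝔻)) :
    ∫ S, generalizationGap 𝔻 H S ∂(Measure.pi fun _ => 𝔻) ≤ β := by
  have hm' : (0 : ℝ) < m := Nat.cast_pos.2 hm
  set R := ∫ S, ∫ z, H S z ∂𝔻 ∂(Measure.pi fun _ => 𝔻)
  have hsum : m * R ≤ ∑ i, ∫ S, H S (S i) ∂(Measure.pi fun _ => 𝔻) + m * β := by
    calc m * R = ∑ _i : Fin m, R := by simp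
      _ ≤ ∑ i, (∫ S, H S (S i) ∂(Measure.pi fun _ => 𝔻) + β) :=
          Finset.sum_le_sum fun i _ => hH.integral_integral_le hHint i (hHi i)
      _ = _ := by simp [Finset.sum_add_distrib]
  have hrisk : Integrable (fun S => ∫ z, H S z ∂𝔻) (Measure.pi fun _ => 𝔻) :=
    hHint.integral_prod_left
  simp only [generalizationGap]
  rw [integral_sub hrisk ((integrable_finsetSum _ fun i _ => hHi i).div_const _),
    integral_div, integral_finsetSum _ fun i _ => hHi i, sub_le_iff_le_add',
    ← sub_le_iff_le_add, le_div_iff₀ hm']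
  linarith

theorem hasBoundedDifferences_generalizationGap (hH : UniformlyStable H β) (hm : 0 < m)
    (hM : ∀ S z, H S z ∈ Set.Icc (0 : ℝ) M) (hHint : ∀ S, Integrable (H S) 𝔻) :
    HasBoundedDifferences (generalizationGap 𝔻 H) fun _ => 2 * β + M / m := by
  intro S i w
  have hm' : (0 : ℝ) < m := Nat.cast_pos.2 hm
  have hrisk : |∫ z, H (Function.update S i w) z ∂𝔻 - ∫ z, H S z ∂𝔻| ≤ β := by
    rw [← integral_sub (hHint _) (hHint _), ← Real.norm_eq_abs, ← mul_one (β : ℝ),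
      ← probReal_univ (μ := 𝔻)]
    exact norm_integral_le_of_norm_le_const (ae_of_all _ fun z => hH S i w z)
  have hemp : |(∑ k, H (Function.update S i w) (Function.update S i w k) - ∑ k, H S (S k)) / m|
      ≤ β + M / m := by
    rw [abs_div, abs_of_pos hm', div_le_iff₀ hm', add_mul, div_mul_cancel₀ _ hm'.ne', mul_comm]
    exact hH.abs_sum_update_sub_sum_le hM S i w
  calc |generalizationGap 𝔻 H (Function.update S i w) - generalizationGap 𝔻 H S|
      = |(∫ z, H (Function.update S i w) z ∂𝔻 - ∫ z, H S z ∂𝔻)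
          - (∑ k, H (Function.update S i w) (Function.update S i w k) - ∑ k, H S (S k)) / m| := by
        simp only [generalizationGap]; ring_nf
    _ ≤ β + (β + M / m) := (abs_sub _ _).trans (add_le_add hrisk hemp)
    _ = (2 * β + M / m : ℝ≥0) := by push_cast; ring

/-- The high-probability generalization bound of Bousquet and Elisseeff. -/
theorem measure_generalizationGap_le (hH : UniformlyStable H β) (hm : 0 < m)
    (hHm : Measurable (Function.uncurry H)) (hM : ∀ S z, H S z ∈ Set.Icc (0 : ℝ) M) {δ : ℝ}
    (hδ : δ ∈ Set.Ioo (0 : ℝ) 1) :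
    ENNReal.ofReal (1 - δ) ≤ Measure.pi (fun _ : Fin m => 𝔻)
      {S | generalizationGap 𝔻 H S ≤ β + (2 * m * β + M) * √(Real.log (1 / δ) / (2 * m))} := by
  have hint : ∀ {Ω : Type _} [MeasurableSpace Ω] (μ : Measure Ω) [IsFiniteMeasure μ] {f : Ω → ℝ},
      Measurable f → (∀ x, f x ∈ Set.Icc (0 : ℝ) M) → Integrable f μ := fun μ _ _ hf hfM =>
    Integrable.of_mem_Icc 0 M hf.aemeasurable (ae_of_all μ hfM)
  have hHi : ∀ i, Measurable fun S => H S (S i) := fun i =>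
    hHm.comp (measurable_id.prodMk (measurable_pi_apply i))
  have hgap : Measurable (generalizationGap 𝔻 H) :=
    hHm.stronglyMeasurable.integral_prod_right'.measurable.sub
      ((Finset.measurable_sum _ fun i _ => hHi i).div_const _)
  have hmean : ∫ S, generalizationGap 𝔻 H S ∂(Measure.pi fun _ => 𝔻) ≤ β :=
    hH.integral_generalizationGap_le hm (hint _ hHm fun q => hM q.1 q.2)
      fun i => hint _ (hHi i) fun S => hM S (S i)
  have hdev := measure_le_sqrt_of_hasSubgaussianMGF
    ((hH.hasBoundedDifferences_generalizationGap hm hM fun S =>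
      hint 𝔻 (hHm.comp measurable_prodMk_left) (hM S)).hasSubgaussianMGF (fun _ => 𝔻) hgap) hδ
  have hsqrt : √(2 * (∑ _i : Fin m, ((2 * β + M / m) / 2) ^ 2 : ℝ≥0) * Real.log (1 / δ))
      = (2 * m * β + M) * √(Real.log (1 / δ) / (2 * m)) := by
    rw [← Real.sqrt_sq (by positivity : (0 : ℝ) ≤ 2 * m * β + M), ← Real.sqrt_mul (sq_nonneg _)]
    have hm' : (m : ℝ) ≠ 0 := Nat.cast_ne_zero.2 hm.ne'
    congr 1
    simp only [Finset.sum_const, Finset.card_univ, Fintype.card_fin, nsmul_eq_mul]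
    push_cast
    field_simp
  refine hdev.trans (measure_mono (Set.ofPred_subset_ofPred.2 fun S hS => ?_))
  rw [hsqrt] at hS
  linarith

end UniformlyStable

end UniformStability

section StochasticGradientDescent

theorem integral_generalizationGap {Ω Z : Type*} [MeasurableSpace Ω] [MeasurableSpace Z]
    {P : Measure Ω} [SFinite P] {𝔻 : Measure Z} [SFinite 𝔻] {m : ℕ}
    {h : Ω → (Fin m → Z) → Z → ℝ} {S : Fin m → Z}
    (hint : Integrable (fun q : Ω × Z => h q.1 S q.2) (P.prod 𝔻))
    (hi : ∀ i, Integrable (fun r => h r S (S i)) P) :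
    ∫ r, generalizationGap 𝔻 (h r) S ∂P = generalizationGap 𝔻 (fun S z => ∫ r, h r S z ∂P) S := by
  have hrisk : Integrable (fun r => ∫ z, h r S z ∂𝔻) P := hint.integral_prod_left
  simp only [generalizationGap]
  rw [integral_sub hrisk ((integrable_finsetSum _ fun i _ => hi i).div_const _), integral_div,
    integral_finsetSum _ fun i _ => hi i, integral_integral_swap hint]

theorem integral_pi_uniformOn_univ {ι α : Type*} [Fintype ι] [DecidableEq ι] [Fintype α]
    [MeasurableSpace α] [MeasurableSingletonClass α] (f : (ι → α) → ℝ) :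
    ∫ ω, f ω ∂(Measure.pi fun _ => uniformOn Set.univ)
      = (∑ ω, f ω) / (Fintype.card α : ℝ) ^ Fintype.card ι := by
  have hsingleton : ∀ ω : ι → α, (Measure.pi fun _ => uniformOn (Set.univ : Set α)).real {ω}
      = ((Fintype.card α : ℝ) ^ Fintype.card ι)⁻¹ := fun ω => by
    simp [measureReal_def, Measure.pi_singleton, uniformOn_univ]
  rw [integral_fintype .of_finite]
  simp_rw [hsingleton, smul_eq_mul, ← Finset.mul_sum, inv_mul_eq_div]

theorem measureReal_exists_apply_eq_le {ι α : Type*} [Fintype ι] [Fintype α] [MeasurableSpace α]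
    [MeasurableSingletonClass α] (a : α) :
    (Measure.pi fun _ : ι => uniformOn (Set.univ : Set α)).real {ω | ∃ t, ω t = a}
      ≤ Fintype.card ι / Fintype.card α := by
  have : Nonempty α := ⟨a⟩
  have hsingle : ∀ t, (Measure.pi fun _ : ι => uniformOn (Set.univ : Set α)).real {ω | ω t = a}
      = 1 / Fintype.card α := fun t => by
    have hpre := (measurePreserving_eval (fun _ : ι => uniformOn (Set.univ : Set α))
      t).measureReal_preimage (measurableSet_singleton a).nullMeasurableSet
    exact hpre.trans (by simp [measureReal_def, uniformOn_univ])
  calc _ = (Measure.pi fun _ : ι => uniformOn (Set.univ : Set α)).real (⋃ t, {ω | ω t = a}) := by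
        rw [← Set.ofPred_exists]
    _ ≤ ∑ t, (Measure.pi fun _ : ι => uniformOn (Set.univ : Set α)).real {ω | ω t = a} :=
        measureReal_iUnion_fintype_le _
    _ = Fintype.card ι / Fintype.card α := by simp [hsingle, div_eq_mul_inv]

theorem measurable_deriv_of_differentiableAt {X : Type*} [MeasurableSpace X] {f : X → ℝ → ℝ}
    (hf : Measurable (Function.uncurry f)) {g : X → ℝ} (hg : Measurable g)
    (hd : ∀ x, DifferentiableAt ℝ (f x) (g x)) : Measurable fun x => deriv (f x) (g x) := by
  have hquot : ∀ n : ℕ, Measurable fun x =>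
      (1 / ((n : ℝ) + 1))⁻¹ • (f x (g x + 1 / ((n : ℝ) + 1)) - f x (g x)) := fun n => by
    have hshift : Measurable fun x => f x (g x + 1 / ((n : ℝ) + 1)) :=
      hf.comp (measurable_id.prodMk (hg.add_const _))
    have hbase : Measurable fun x => f x (g x) := hf.comp (measurable_id.prodMk hg)
    exact (hshift.sub hbase).const_smul (1 / ((n : ℝ) + 1))⁻¹
  refine measurable_of_tendsto_metrizable hquot (tendsto_pi_nhds.2 fun x => ?_)
  exact (hasDerivAt_iff_tendsto_slope_zero.1 (hd x).hasDerivAt).comp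
    (tendsto_nhdsWithin_iff.2 ⟨tendsto_one_div_add_atTop_nhds_zero_nat,
      .of_forall fun n => Nat.one_div_pos_of_nat.ne'⟩)

theorem abs_sub_le_of_lipschitzWith_update {ι : Type*} [Fintype ι] [DecidableEq ι]
    {f : (ι → ℝ) → ℝ} {κ : ℝ≥0} (hf : ∀ θ j, LipschitzWith κ fun u => f (Function.update θ j u))
    (x y : ι → ℝ) : |f x - f y| ≤ κ * ∑ j, |x j - y j| := by
  rw [Finset.mul_sum]
  refine abs_sub_le_sum_of_update (d := fun _ a b => κ * |a - b|) (fun θ j a => ?_) x y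
  simpa [Real.dist_eq] using (hf θ j).dist_le_mul a (θ j)

variable {Z ι : Type*} [DecidableEq ι] {m T : ℕ}

/-- A gradient step for the objective `F z` with learning rate `η`. -/
noncomputable def gradientStep (F : Z → (ι → ℝ) → ℝ) (η : ℝ) (z : Z) (θ : ι → ℝ) : ι → ℝ :=
  fun j => θ j - η * deriv (fun u => F z (Function.update θ j u)) (θ j)

/-- The parameters reached from `θ₀` by stochastic gradient descent on the training set `S`, when
step `t` uses the sample with index `ω t`. -/
noncomputable def sgdIterate (F : Z → (ι → ℝ) → ℝ) (η : ℝ) (S : Fin m → Z) (ω : Fin T → Fin m)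
    (θ₀ : ι → ℝ) : ι → ℝ :=
  (List.ofFn ω).foldl (fun θ i => gradientStep F η (S i) θ) θ₀

variable {F : Z → (ι → ℝ) → ℝ} {η : ℝ} {κ : ℝ≥0}

theorem abs_gradientStep_sub_le (hη : 0 ≤ η)
    (hF : ∀ z θ j, LipschitzWith κ fun u => F z (Function.update θ j u)) (z : Z) (θ : ι → ℝ)
    (j : ι) : |gradientStep F η z θ j - θ j| ≤ η * κ := by
  rw [gradientStep, sub_sub_cancel_left, abs_neg, abs_mul, abs_of_nonneg hη]
  exact mul_le_mul_of_nonneg_left (norm_deriv_le_of_lipschitz (hF z θ j)) hη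

theorem abs_sgdIterate_sub_le (hη : 0 ≤ η)
    (hF : ∀ z θ j, LipschitzWith κ fun u => F z (Function.update θ j u)) (S : Fin m → Z)
    (ω : Fin T → Fin m) (θ₀ : ι → ℝ) (j : ι) :
    |sgdIterate F η S ω θ₀ j - θ₀ j| ≤ T * (η * κ) := by
  have hfold : ∀ (is : List (Fin m)) (θ : ι → ℝ),
      |is.foldl (fun θ i => gradientStep F η (S i) θ) θ j - θ j| ≤ is.length * (η * κ) := by
    intro is
    induction is with
    | nil => simp
    | cons i is ih =>
      intro θ
      calc _ ≤ is.length * (η * κ) + η * κ :=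
            (abs_sub_le _ (gradientStep F η (S i) θ j) _).trans
              (add_le_add (ih _) (abs_gradientStep_sub_le hη hF (S i) θ j))
        _ = (i :: is).length * (η * κ) := by push_cast [List.length_cons]; ring
  simpa only [sgdIterate, List.length_ofFn] using hfold (List.ofFn ω) θ₀

theorem sgdIterate_update_of_forall_ne {ω : Fin T → Fin m} {i : Fin m} (hi : ∀ t, ω t ≠ i)
    (S : Fin m → Z) (w : Z) (θ₀ : ι → ℝ) :
    sgdIterate F η (Function.update S i w) ω θ₀ = sgdIterate F η S ω θ₀ := by
  refine List.foldl_ext _ _ _ fun θ k hk => ?_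
  obtain ⟨t, rfl⟩ := (List.mem_ofFn' ω k).1 hk
  rw [Function.update_of_ne (hi t)]

theorem abs_comp_sgdIterate_update_sub_le [Fintype ι] (hη : 0 ≤ η)
    (hF : ∀ z θ j, LipschitzWith κ fun u => F z (Function.update θ j u)) (S : Fin m → Z)
    (i : Fin m) (w z : Z) (ω : Fin T → Fin m) (θ₀ : ι → ℝ) :
    |F z (sgdIterate F η (Function.update S i w) ω θ₀) - F z (sgdIterate F η S ω θ₀)|
      ≤ {ω : Fin T → Fin m | ∃ t, ω t = i}.indicator
          (fun _ => 2 * Fintype.card ι * η * T * (κ : ℝ) ^ 2) ω := by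
  by_cases hω : ω ∈ {ω : Fin T → Fin m | ∃ t, ω t = i}
  · have hdrift : ∀ j, |sgdIterate F η (Function.update S i w) ω θ₀ j - sgdIterate F η S ω θ₀ j|
        ≤ T * (η * κ) + T * (η * κ) := fun j =>
      (abs_sub_le _ (θ₀ j) _).trans (add_le_add (abs_sgdIterate_sub_le hη hF _ ω θ₀ j)
        (abs_sub_comm (θ₀ j) _ ▸ abs_sgdIterate_sub_le hη hF S ω θ₀ j))
    rw [Set.indicator_of_mem hω]
    calc _ ≤ κ * ∑ j, |sgdIterate F η (Function.update S i w) ω θ₀ j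
            - sgdIterate F η S ω θ₀ j| := abs_sub_le_of_lipschitzWith_update (hF z) _ _
      _ ≤ κ * ∑ _j : ι, (T * (η * κ) + T * (η * κ)) := by gcongr with j; exact hdrift j
      _ = _ := by simp only [Finset.sum_const, Finset.card_univ, nsmul_eq_mul]; ring
  · rw [Set.indicator_of_notMem hω,
      sgdIterate_update_of_forall_ne (fun t ht => hω ⟨t, ht⟩) S w θ₀, sub_self, abs_zero]

variable [MeasurableSpace Z]

theorem measurable_gradientStep (hFm : Measurable (Function.uncurry F))
    (hFd : ∀ z θ j, DifferentiableAt ℝ (fun u => F z (Function.update θ j u)) (θ j)) :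
    Measurable (Function.uncurry (gradientStep F η)) := by
  refine measurable_pi_iff.2 fun j => ?_
  have hcoord : Measurable fun q : Z × (ι → ℝ) => q.2 j :=
    (measurable_pi_apply j).comp measurable_snd
  have hupdate : Measurable fun a : (Z × (ι → ℝ)) × ℝ =>
      F a.1.1 (Function.update a.1.2 j a.2) :=
    hFm.comp (measurable_fst.fst.prodMk
      (measurable_update'.comp (measurable_fst.snd.prodMk measurable_snd)))
  exact hcoord.sub ((measurable_deriv_of_differentiableAt
    (f := fun q u => F q.1 (Function.update q.2 j u)) hupdate hcoord
    fun q => hFd q.1 q.2 j).const_mul η)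

theorem measurable_sgdIterate (hFm : Measurable (Function.uncurry F))
    (hFd : ∀ z θ j, DifferentiableAt ℝ (fun u => F z (Function.update θ j u)) (θ j))
    (ω : Fin T → Fin m) :
    Measurable fun q : (Fin m → Z) × (ι → ℝ) => sgdIterate F η q.1 ω q.2 := by
  have hfold : ∀ (is : List (Fin m)) (θ : (Fin m → Z) × (ι → ℝ) → ι → ℝ), Measurable θ →
      Measurable fun q => is.foldl (fun θ i => gradientStep F η (q.1 i) θ) (θ q) := by
    intro is
    induction is with
    | nil => exact fun θ hθ => hθ
    | cons i _ ih =>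
      exact fun θ hθ => ih _ ((measurable_gradientStep hFm hFd).comp
        (((measurable_pi_apply i).comp measurable_fst).prodMk hθ))
  exact hfold _ _ measurable_snd

variable {M : ℝ≥0} {ν : Measure (ι → ℝ)}

/-- The joint law of the random choices made by SGD: the initial parameters `θ₀` are drawn from `ν`,
and the sample indices `ω` of the `T` steps are independent and uniform on `Fin m`. -/
noncomputable def sgdRandomness (m T : ℕ) (ν : Measure (ι → ℝ)) :
    Measure ((ι → ℝ) × (Fin T → Fin m)) :=
  ν.prod (Measure.pi fun _ => uniformOn Set.univ)

instance [NeZero m] [IsProbabilityMeasure ν] : IsProbabilityMeasure (sgdRandomness m T ν) := by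
  unfold sgdRandomness; infer_instance

/-- The expected loss at `z` of the parameters learned by `T` steps of SGD from `S`. -/
noncomputable def sgdLoss (F : Z → (ι → ℝ) → ℝ) (η : ℝ) (T : ℕ) (ν : Measure (ι → ℝ))
    (S : Fin m → Z) (z : Z) : ℝ :=
  ∫ r, F z (sgdIterate F η S r.2 r.1) ∂sgdRandomness m T ν

theorem measurable_comp_sgdIterate (hFm : Measurable (Function.uncurry F))
    (hFd : ∀ z θ j, DifferentiableAt ℝ (fun u => F z (Function.update θ j u)) (θ j)) :
    Measurable fun q : ((Fin m → Z) × Z) × ((ι → ℝ) × (Fin T → Fin m)) =>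
      F q.1.2 (sgdIterate F η q.1.1 q.2.2 q.2.1) := by
  have hiterate : Measurable fun q : (Fin T → Fin m) × ((Fin m → Z) × (ι → ℝ)) =>
      sgdIterate F η q.2.1 q.1 q.2.2 :=
    measurable_from_prod_countable_right fun ω => measurable_sgdIterate hFm hFd ω
  exact hFm.comp (measurable_fst.snd.prodMk (hiterate.comp
    (measurable_snd.snd.prodMk (measurable_fst.fst.prodMk measurable_snd.fst))))

section

variable [NeZero m] [IsProbabilityMeasure ν]

theorem integrable_comp_sgdIterate (hFm : Measurable (Function.uncurry F))
    (hFd : ∀ z θ j, DifferentiableAt ℝ (fun u => F z (Function.update θ j u)) (θ j))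
    (hFM : ∀ z θ, F z θ ∈ Set.Icc (0 : ℝ) M) (S : Fin m → Z) (z : Z) :
    Integrable (fun r => F z (sgdIterate F η S r.2 r.1)) (sgdRandomness m T ν) :=
  .of_mem_Icc 0 M ((measurable_comp_sgdIterate hFm hFd).comp
    (measurable_prodMk_left (x := (S, z)))).aemeasurable
    (ae_of_all _ fun _ => hFM z _)

/-- Two runs whose training sets differ in one sample agree unless that sample is drawn, which
happens with probability at most `T / m`. -/
theorem uniformlyStable_sgdLoss [Fintype ι] {η : ℝ≥0} (hFm : Measurable (Function.uncurry F))
    (hFd : ∀ z θ j, DifferentiableAt ℝ (fun u => F z (Function.update θ j u)) (θ j))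
    (hFM : ∀ z θ, F z θ ∈ Set.Icc (0 : ℝ) M)
    (hF : ∀ z θ j, LipschitzWith κ fun u => F z (Function.update θ j u)) :
    UniformlyStable (m := m) (sgdLoss F η T ν) (2 * Fintype.card ι * η * (T * κ) ^ 2 / m) := by
  intro S i w z
  set drawn : Set (Fin T → Fin m) := {ω | ∃ t, ω t = i}
  set C : ℝ := 2 * Fintype.card ι * η * T * (κ : ℝ) ^ 2
  have hdrawn : (sgdRandomness m T ν).real (Prod.snd ⁻¹' drawn) ≤ T / m := by
    have hsnd : (sgdRandomness m T ν).real (Prod.snd ⁻¹' drawn)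
        = (Measure.pi fun _ => uniformOn Set.univ).real drawn :=
      measurePreserving_snd.measureReal_preimage drawn.toFinite.measurableSet.nullMeasurableSet
    simpa [hsnd] using measureReal_exists_apply_eq_le (ι := Fin T) i
  have hint := integrable_comp_sgdIterate (m := m) (η := η) (T := T) (ν := ν) hFm hFd hFM
  calc |sgdLoss F η T ν (Function.update S i w) z - sgdLoss F η T ν S z|
      = |∫ r, (F z (sgdIterate F η (Function.update S i w) r.2 r.1)
          - F z (sgdIterate F η S r.2 r.1)) ∂sgdRandomness m T ν| := by
        rw [integral_sub (hint _ z) (hint _ z)]; rfl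
    _ ≤ ∫ r, (Prod.snd ⁻¹' drawn).indicator (fun _ => C) r ∂sgdRandomness m T ν := by
        rw [← Real.norm_eq_abs]
        exact norm_integral_le_of_norm_le ((integrable_const C).indicator
          (measurable_snd drawn.toFinite.measurableSet)) (ae_of_all _ fun r =>
            abs_comp_sgdIterate_update_sub_le η.2 hF S i w z r.2 r.1)
    _ = (sgdRandomness m T ν).real (Prod.snd ⁻¹' drawn) * C := by
        rw [integral_indicator_const _ (measurable_snd drawn.toFinite.measurableSet), smul_eq_mul]
    _ ≤ T / m * C := mul_le_mul_of_nonneg_right hdrawn (by positivity)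
    _ = _ := by simp only [C]; push_cast; ring

theorem measure_generalizationGap_sgdLoss_le [Fintype ι] {η : ℝ≥0}
    (hFm : Measurable (Function.uncurry F))
    (hFd : ∀ z θ j, DifferentiableAt ℝ (fun u => F z (Function.update θ j u)) (θ j))
    (hFM : ∀ z θ, F z θ ∈ Set.Icc (0 : ℝ) M)
    (hF : ∀ z θ j, LipschitzWith κ fun u => F z (Function.update θ j u)) (T : ℕ) (𝔻 : Measure Z)
    [IsProbabilityMeasure 𝔻] {δ : ℝ} (hδ : δ ∈ Set.Ioo (0 : ℝ) 1) :
    ENNReal.ofReal (1 - δ) ≤ Measure.pi (fun _ : Fin m => 𝔻)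
      {S | generalizationGap 𝔻 (sgdLoss F η T ν) S ≤ 2 * Fintype.card ι * η * (T * κ) ^ 2 / m
        + (4 * Fintype.card ι * η * (T * κ) ^ 2 + M) * √(Real.log (1 / δ) / (2 * m))} := by
  have hm : (m : ℝ) ≠ 0 := NeZero.ne _
  have hmem : ∀ S z, sgdLoss (m := m) F η T ν S z ∈ Set.Icc (0 : ℝ) M := fun S z =>
    ⟨integral_nonneg fun r => (hFM z _).1, by
      simpa [sgdLoss] using integral_mono (integrable_comp_sgdIterate (ν := ν) hFm hFd hFM S z)
        (integrable_const (M : ℝ)) fun r => (hFM z _).2⟩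
  have hmeas : Measurable (Function.uncurry (sgdLoss (m := m) F η T ν)) :=
    (measurable_comp_sgdIterate hFm hFd).stronglyMeasurable.integral_prod_right'.measurable
  have hstable := uniformlyStable_sgdLoss (m := m) (η := η) (T := T) (ν := ν) hFm hFd hFM hF
  have hgap := hstable.measure_generalizationGap_le (𝔻 := 𝔻) (NeZero.pos m) hmeas hmem hδ
  convert hgap using 7
  · push_cast; rfl
  · push_cast; field_simp; ring

end

theorem integral_sum_generalizationGap [NeZero m] [IsProbabilityMeasure ν]
    (hFm : Measurable (Function.uncurry F))
    (hFd : ∀ z θ j, DifferentiableAt ℝ (fun u => F z (Function.update θ j u)) (θ j))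
    (hFM : ∀ z θ, F z θ ∈ Set.Icc (0 : ℝ) M) (𝔻 : Measure Z) [IsProbabilityMeasure 𝔻]
    (S : Fin m → Z) :
    ∫ θ₀, (∑ ω : Fin T → Fin m, generalizationGap 𝔻 (fun S z => F z (sgdIterate F η S ω θ₀)) S)
        / (m : ℝ) ^ T ∂ν
      = generalizationGap 𝔻 (sgdLoss F η T ν) S := by
  have hjoint : Integrable (fun q : ((ι → ℝ) × (Fin T → Fin m)) × Z =>
      F q.2 (sgdIterate F η S q.1.2 q.1.1)) ((sgdRandomness m T ν).prod 𝔻) :=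
    .of_mem_Icc 0 M ((measurable_comp_sgdIterate hFm hFd).comp
      ((measurable_const.prodMk measurable_snd).prodMk measurable_fst)).aemeasurable
      (ae_of_all _ fun q => hFM q.2 _)
  have hgap : Integrable (fun r : (ι → ℝ) × (Fin T → Fin m) =>
      generalizationGap 𝔻 (fun S z => F z (sgdIterate F η S r.2 r.1)) S) (sgdRandomness m T ν) :=
    hjoint.integral_prod_left.sub ((integrable_finsetSum _ fun i _ =>
      integrable_comp_sgdIterate hFm hFd hFM S (S i)).div_const _)
  have hω : ∀ f : (Fin T → Fin m) → ℝ, (∑ ω, f ω) / (m : ℝ) ^ T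
      = ∫ ω, f ω ∂(Measure.pi fun _ => uniformOn Set.univ) := fun f => by
    rw [integral_pi_uniformOn_univ, Fintype.card_fin, Fintype.card_fin]
  simp_rw [hω]
  rw [← integral_prod _ hgap]
  exact integral_generalizationGap hjoint fun i => integrable_comp_sgdIterate hFm hFd hFM S (S i)

/-- Hypotheses on almost every sample suffice: composing `F` with a measurable map into the good set
that is almost everywhere the identity makes them hold everywhere. -/
theorem measure_integral_sum_generalizationGap_le [Fintype ι] [NeZero m] [IsProbabilityMeasure ν]
    {𝔻 : Measure Z} [IsProbabilityMeasure 𝔻] {η : ℝ≥0} {s : Set Z} (hs : ∀ᵐ z ∂𝔻, z ∈ s)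
    (hFm : Measurable (Function.uncurry F))
    (hFd : ∀ z ∈ s, ∀ θ j, DifferentiableAt ℝ (fun u => F z (Function.update θ j u)) (θ j))
    (hFM : ∀ z ∈ s, ∀ θ, F z θ ∈ Set.Icc (0 : ℝ) M)
    (hF : ∀ z ∈ s, ∀ θ j, LipschitzWith κ fun u => F z (Function.update θ j u)) (T : ℕ)
    {δ : ℝ} (hδ : δ ∈ Set.Ioo (0 : ℝ) 1) :
    ENNReal.ofReal (1 - δ) ≤ Measure.pi (fun _ : Fin m => 𝔻)
      {S | ∫ θ₀, (∑ ω : Fin T → Fin m,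
          generalizationGap 𝔻 (fun S z => F z (sgdIterate F η S ω θ₀)) S) / (m : ℝ) ^ T ∂ν
        ≤ 2 * Fintype.card ι * η * (T * κ) ^ 2 / m
          + (4 * Fintype.card ι * η * (T * κ) ^ 2 + M) * √(Real.log (1 / δ) / (2 * m))} := by
  obtain ⟨π, hπ, hπs, hπ𝔻⟩ := aemeasurable_id.exists_ae_eq_range_subset hs hs.exists
  replace hπs : ∀ z, π z ∈ s := fun z => hπs ⟨z, rfl⟩
  have hFm' : Measurable (Function.uncurry fun z => F (π z)) :=
    hFm.comp ((hπ.comp measurable_fst).prodMk measurable_snd)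
  have hFd' := fun z => hFd (π z) (hπs z)
  have hFM' := fun z => hFM (π z) (hπs z)
  refine (measure_generalizationGap_sgdLoss_le (ν := ν) (η := η) hFm' hFd' hFM'
    (fun z => hF (π z) (hπs z)) T 𝔻 hδ).trans (measure_mono_ae ?_)
  have hfix : ∀ᵐ S ∂Measure.pi fun _ : Fin m => 𝔻, ∀ i, π (S i) = S i :=
    Filter.eventually_all.2 fun i =>
      (Measure.tendsto_eval_ae_ae (μ := fun _ : Fin m => 𝔻) (i := i)).eventually hπ𝔻.symm
  filter_upwards [hfix] with S hS hgap
  refine le_of_eq_of_le ?_ hgap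
  rw [← integral_sum_generalizationGap hFm' hFd' hFM']
  have hrun (ω : Fin T → Fin m) (θ₀ : ι → ℝ) :
      sgdIterate F η S ω θ₀ = sgdIterate (fun z => F (π z)) η S ω θ₀ := by
    change _ = sgdIterate F η (fun i => π (S i)) ω θ₀
    rw [funext hS]
  have hrisk : ∀ θ, ∫ z, F z θ ∂𝔻 = ∫ z, F (π z) θ ∂𝔻 := fun θ =>
    integral_congr_ae (hπ𝔻.mono fun z hz => congrArg (F · θ) hz)
  simp only [generalizationGap, hrun, hrisk, hS]

end StochasticGradientDescent

namespace NoisyQNN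

open Matrix

section Rotations

variable {N : ℕ}

theorem onQubit_mul (q : Fin N) (A B : Matrix (Fin 2) (Fin 2) ℂ) :
    onQubit q A * onQubit q B = onQubit q (A * B) := by
  ext s t
  simp only [Matrix.mul_apply, onQubit, Matrix.of_apply]
  rw [← Finset.sum_of_injOn (s := Finset.univ)
    (f := fun a => if ∀ r, r ≠ q → s r = t r then A (s q) a * B a (t q) else 0)
    (Function.update s q) (Function.update_injective s q).injOn (by simp)]
  · split_ifs <;> simp
  · intro u _ hu
    have hne : ¬ ∀ r, r ≠ q → s r = u r := fun h =>
      hu ⟨u q, by simp, Function.update_eq_iff.2 ⟨rfl, h⟩⟩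
    rw [if_neg hne, zero_mul]
  · intro a _
    have hs : ∀ r, r ≠ q → s r = Function.update s q a r := fun r hr => by simp [hr]
    have ht : (∀ r, r ≠ q → Function.update s q a r = t r) ↔ ∀ r, r ≠ q → s r = t r :=
      forall₂_congr fun r hr => by simp [hr]
    simp only [if_pos hs, ht, Function.update_self, mul_ite, mul_zero]

theorem onQubit_one (q : Fin N) : onQubit q (1 : Matrix (Fin 2) (Fin 2) ℂ) = 1 := by
  ext s t
  have hst : s = t ↔ (∀ r, r ≠ q → s r = t r) ∧ s q = t q := by
    refine ⟨by rintro rfl; simp, fun h => funext fun r => ?_⟩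
    by_cases hr : r = q
    exacts [hr ▸ h.2, h.1 r hr]
  simp only [onQubit, Matrix.of_apply, Matrix.one_apply, hst, ite_and]

theorem conjTranspose_onQubit (q : Fin N) (A : Matrix (Fin 2) (Fin 2) ℂ) :
    (onQubit q A)ᴴ = onQubit q Aᴴ := by
  ext s t
  simp only [onQubit, Matrix.of_apply, Matrix.conjTranspose_apply, eq_comm (a := s _),
    apply_ite star, star_zero]

theorem Pauli.toMatrix_mul_self (P : Pauli) : P.toMatrix * P.toMatrix = 1 := by
  cases P <;> ext i j <;> fin_cases i <;> fin_cases j <;> simp [Pauli.toMatrix, Matrix.mul_apply]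

theorem Pauli.isHermitian_toMatrix (P : Pauli) : P.toMatrix.IsHermitian := by
  cases P <;> ext i j <;> fin_cases i <;> fin_cases j <;> simp [Pauli.toMatrix]

theorem onQubit_toMatrix_mul_self (q : Fin N) (P : Pauli) :
    onQubit q P.toMatrix * onQubit q P.toMatrix = 1 := by
  rw [onQubit_mul, P.toMatrix_mul_self, onQubit_one]

theorem isHermitian_onQubit_toMatrix (q : Fin N) (P : Pauli) :
    (onQubit q P.toMatrix).IsHermitian := by
  rw [Matrix.IsHermitian, conjTranspose_onQubit, P.isHermitian_toMatrix]

theorem exp_smul_of_mul_self_eq_one {𝔸 : Type*} [Ring 𝔸] [Algebra ℂ 𝔸] [TopologicalSpace 𝔸]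
    [IsTopologicalRing 𝔸] [ContinuousSMul ℂ 𝔸] [T2Space 𝔸] {a : 𝔸} (ha : a * a = 1) (z : ℂ) :
    NormedSpace.exp (z • a) = Complex.cosh z • (1 : 𝔸) + Complex.sinh z • a := by
  have heven : ∀ k : ℕ, a ^ (2 * k) = 1 := fun k => by rw [pow_mul, sq, ha, one_pow]
  have hodd : ∀ k : ℕ, a ^ (2 * k + 1) = a := fun k => by rw [pow_succ, heven, one_mul]
  rw [NormedSpace.exp_eq_tsum ℂ]
  refine HasSum.tsum_eq (HasSum.even_add_odd ?_ ?_)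
  · convert! (Complex.hasSum_cosh z).smul_const (1 : 𝔸) using 2 with k
    rw [smul_pow, heven, smul_smul, div_eq_inv_mul]
  · convert! (Complex.hasSum_sinh z).smul_const a using 2 with k
    rw [smul_pow, hodd, smul_smul, div_eq_inv_mul]

theorem pauliRotation_eq (P : Pauli) (q : Fin N) (φ : ℝ) :
    pauliRotation P q φ = (Real.cos (φ / 2) : ℂ) • (1 : Op N)
      - (Real.sin (φ / 2) * Complex.I : ℂ) • onQubit q P.toMatrix := by
  have hφ : -(Complex.I * (φ : ℂ) / 2) = -(((φ / 2 : ℝ) : ℂ) * Complex.I) := by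
    push_cast; ring
  rw [pauliRotation, exp_smul_of_mul_self_eq_one (onQubit_toMatrix_mul_self q P), hφ,
    Complex.cosh_neg, Complex.sinh_neg, Complex.cosh_mul_I, Complex.sinh_mul_I,
    ← Complex.ofReal_cos, ← Complex.ofReal_sin, neg_smul, sub_eq_add_neg]

theorem conjTranspose_pauliRotation (P : Pauli) (q : Fin N) (φ : ℝ) :
    (pauliRotation P q φ)ᴴ = pauliRotation P q (-φ) := by
  rw [pauliRotation, pauliRotation, ← Matrix.exp_conjTranspose, conjTranspose_smul,
    isHermitian_onQubit_toMatrix]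
  simp

theorem pauliRotation_mem_unitaryGroup (P : Pauli) (q : Fin N) (φ : ℝ) :
    pauliRotation P q φ ∈ unitaryGroup (Basis N) ℂ := by
  rw [mem_unitaryGroup_iff, star_eq_conjTranspose, conjTranspose_pauliRotation, pauliRotation,
    pauliRotation, ← Matrix.exp_add_of_commute _ _ ((Commute.refl _).smul_left _ |>.smul_right _),
    ← add_smul]
  simp [neg_div]

theorem continuous_pauliRotation (P : Pauli) (q : Fin N) :
    Continuous fun φ : ℝ => pauliRotation P q φ := by
  simp_rw [pauliRotation_eq]
  fun_prop

end Rotations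

section Circuits

variable {N : ℕ} {ι : Type}

theorem Gate.toOp_mem_unitaryGroup (v : ι → ℝ) (g : Gate N ι) :
    g.toOp v ∈ unitaryGroup (Basis N) ℂ := by
  cases g with
  | fixed V => exact V.2
  | rotation i P q => exact pauliRotation_mem_unitaryGroup P q (v i)

theorem Gate.continuous_toOp (g : Gate N ι) : Continuous fun v : ι → ℝ => g.toOp v := by
  cases g with
  | fixed V => exact continuous_const
  | rotation i P q => exact (continuous_pauliRotation P q).comp (continuous_apply i)

theorem Gate.toOp_update_of_ne [DecidableEq ι] {g : Gate N ι} {j : ι} (h : g.coord? ≠ some j)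
    (v : ι → ℝ) (u : ℝ) : g.toOp (Function.update v j u) = g.toOp v := by
  cases g with
  | fixed V => rfl
  | rotation i P q =>
    have hij : i ≠ j := fun hij => h (congrArg some hij)
    simp [Gate.toOp, hij]

/-- The unitary implemented by a circuit at the angle vector `v`; the gates act from left to right,
so they are multiplied in reverse order. -/
noncomputable def circuitOp (v : ι → ℝ) (gs : List (Gate N ι)) : Op N :=
  (gs.map (Gate.toOp v)).reverse.prod

theorem circuitOp_append (v : ι → ℝ) (gs hs : List (Gate N ι)) :
    circuitOp v (gs ++ hs) = circuitOp v hs * circuitOp v gs := by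
  simp [circuitOp]

theorem circuitOp_cons (v : ι → ℝ) (g : Gate N ι) (gs : List (Gate N ι)) :
    circuitOp v (g :: gs) = circuitOp v gs * g.toOp v := by
  simp [circuitOp]

theorem continuous_circuitOp (gs : List (Gate N ι)) :
    Continuous fun v : ι → ℝ => circuitOp v gs := by
  induction gs with
  | nil => exact continuous_const
  | cons g gs ih =>
    simp_rw [circuitOp_cons]
    exact ih.mul g.continuous_toOp

theorem circuitOp_mem_unitaryGroup (v : ι → ℝ) (gs : List (Gate N ι)) :
    circuitOp v gs ∈ unitaryGroup (Basis N) ℂ :=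
  Submonoid.list_prod_mem _ fun _ hU => by
    obtain ⟨g, -, rfl⟩ := List.mem_map.1 (List.mem_reverse.1 hU)
    exact g.toOp_mem_unitaryGroup v

theorem circuitOp_update_of_notMem [DecidableEq ι] {gs : List (Gate N ι)} {j : ι}
    (h : j ∉ gs.filterMap Gate.coord?) (v : ι → ℝ) (u : ℝ) :
    circuitOp (Function.update v j u) gs = circuitOp v gs := by
  unfold circuitOp
  congr 2
  exact List.map_congr_left fun g hg =>
    Gate.toOp_update_of_ne (fun hj => h (List.mem_filterMap.2 ⟨g, hg, hj⟩)) v u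

theorem trace_mul_mul_conjTranspose_of_mem_unitaryGroup {n α : Type*} [Fintype n] [DecidableEq n]
    [CommRing α] [StarRing α] {U : Matrix n n α} (hU : U ∈ unitaryGroup n α) (ρ : Matrix n n α) :
    (U * ρ * Uᴴ).trace = ρ.trace := by
  rw [Matrix.trace_mul_comm, ← Matrix.mul_assoc, ← star_eq_conjTranspose,
    mem_unitaryGroup_iff'.1 hU, Matrix.one_mul]

/-- The maximally mixed state is invariant under unitaries, so the noise of all gates can be moved
to the end of the circuit. -/
theorem foldl_depolarize (p : ℝ) (v : ι → ℝ) (gs : List (Gate N ι)) (ρ : Op N) :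
    (gs.map (Gate.toOp v)).foldl (fun ρ U => depolarize p (U * ρ * Uᴴ)) ρ
      = (((1 - p) ^ gs.length : ℝ) : ℂ) • (circuitOp v gs * ρ * (circuitOp v gs)ᴴ)
        + (((1 - (1 - p) ^ gs.length : ℝ) : ℂ) * ρ.trace / 2 ^ N) • (1 : Op N) := by
  induction gs generalizing ρ with
  | nil => simp [circuitOp]
  | cons g gs ih =>
    have htrace := trace_mul_mul_conjTranspose_of_mem_unitaryGroup (g.toOp_mem_unitaryGroup v) ρ
    have hunitary : circuitOp v gs * (circuitOp v gs)ᴴ = 1 :=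
      mem_unitaryGroup_iff.1 (circuitOp_mem_unitaryGroup v gs)
    have hone : (1 : Op N).trace = 2 ^ N := by simp [Matrix.trace_one]
    rw [Matrix.mul_assoc] at htrace
    rw [List.map_cons, List.foldl_cons, ih, circuitOp_cons]
    simp only [depolarize, htrace, trace_add, trace_smul, hone, conjTranspose_mul, Matrix.mul_add,
      Matrix.add_mul, Matrix.mul_smul, Matrix.smul_mul, Matrix.mul_one, hunitary, smul_add,
      smul_smul, Matrix.mul_assoc, add_assoc, ← add_smul, List.length_cons, smul_eq_mul]
    congr 2
    · push_cast; ring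
    · push_cast; field_simp; ring

theorem exists_eq_append_rotation_cons_of_count_eq_one [DecidableEq ι] {gs : List (Gate N ι)}
    {j : ι} (h : (gs.filterMap Gate.coord?).count j = 1) :
    ∃ (l₁ l₂ : List (Gate N ι)) (P : Pauli) (q : Fin N), gs = l₁ ++ Gate.rotation j P q :: l₂ ∧
      j ∉ l₁.filterMap Gate.coord? ∧ j ∉ l₂.filterMap Gate.coord? := by
  have hmem : j ∈ gs.filterMap Gate.coord? := List.count_pos_iff.1 (h ▸ one_pos)
  obtain ⟨g, hg, hgj⟩ := List.mem_filterMap.1 hmem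
  obtain ⟨l₁, l₂, rfl⟩ := List.append_of_mem hg
  cases g with
  | fixed V => simp [Gate.coord?] at hgj
  | rotation i P q =>
    obtain rfl : i = j := Option.some.inj hgj
    rw [List.filterMap_append, List.filterMap_cons_some hgj, List.count_append,
      List.count_cons_self] at h
    refine ⟨l₁, l₂, P, q, rfl, ?_, ?_⟩ <;> rw [← List.count_eq_zero] <;> omega

end Circuits

section Expectation

open scoped MatrixOrder in
theorem norm_trace_mul_le {n : Type*} [Fintype n] [DecidableEq n] {ρ : Matrix n n ℂ}
    (hρ : ρ.PosSemidef) (A : Matrix n n ℂ) :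
    ‖(ρ * A).trace‖ ≤ ‖Matrix.toEuclideanCLM (𝕜 := ℂ) A‖ * ρ.trace.re := by
  obtain ⟨C, rfl⟩ := CStarAlgebra.nonneg_iff_eq_star_mul_self.mp hρ.nonneg
  set x : n → EuclideanSpace ℂ n := fun k => WithLp.toLp 2 (star (C k))
  have htrace_mul : ∀ B : Matrix n n ℂ, (star C * C * B).trace
      = ∑ k, inner ℂ (x k) (Matrix.toEuclideanCLM (𝕜 := ℂ) B (x k)) := fun B => by
    rw [Matrix.mul_assoc, Matrix.trace_mul_comm, Matrix.mul_assoc]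
    refine Finset.sum_congr rfl fun k _ => ?_
    simp only [x, Matrix.toEuclideanCLM_toLp, EuclideanSpace.inner_toLp_toLp, star_star]
    rw [dotProduct_comm]
    rfl
  have htrace : (star C * C).trace.re = ∑ k, ‖x k‖ ^ 2 := by
    have h := htrace_mul 1
    simp only [mul_one, map_one, one_apply_eq_self, inner_self_eq_norm_sq_to_K] at h
    rw [h, Complex.re_sum]
    exact Finset.sum_congr rfl fun k _ => by norm_cast
  rw [htrace_mul, htrace, Finset.mul_sum]
  refine (norm_sum_le _ _).trans (Finset.sum_le_sum fun k _ => (norm_inner_le_norm _ _).trans ?_)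
  calc ‖x k‖ * ‖Matrix.toEuclideanCLM (𝕜 := ℂ) A (x k)‖
      ≤ ‖x k‖ * (‖Matrix.toEuclideanCLM (𝕜 := ℂ) A‖ * ‖x k‖) := by
        gcongr
        exact ContinuousLinearMap.le_opNorm _ _
    _ = _ := by ring

variable {N : ℕ} {ι : Type}

/-- The expectation value of the observable `A` after a noiseless circuit has acted on `ρ`. -/
noncomputable def circuitExp (v : ι → ℝ) (gs : List (Gate N ι)) (ρ A : Op N) : ℝ :=
  (circuitOp v gs * ρ * (circuitOp v gs)ᴴ * A).trace.re

theorem abs_circuitExp_le (v : ι → ℝ) (gs : List (Gate N ι)) {ρ : Op N} (hρ : ρ.PosSemidef)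
    (hρ1 : ρ.trace = 1) (A : Op N) : |circuitExp v gs ρ A| ≤ opNorm A := by
  have h := norm_trace_mul_le (hρ.mul_mul_conjTranspose_same (circuitOp v gs)) A
  rw [trace_mul_mul_conjTranspose_of_mem_unitaryGroup (circuitOp_mem_unitaryGroup v gs), hρ1,
    Complex.one_re, mul_one] at h
  exact (Complex.abs_re_le_norm _).trans h

theorem continuous_circuitExp (gs : List (Gate N ι)) (ρ A : Op N) :
    Continuous fun v : ι → ℝ => circuitExp v gs ρ A := by
  have hgs := continuous_circuitOp gs
  exact Complex.continuous_re.comp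
    (((hgs.mul continuous_const).mul hgs.matrix_conjTranspose).mul continuous_const).matrix_trace

/-- Trigonometric polynomials of degree at most one. This is how an expectation value depends on the
angle of a single Pauli rotation. -/
def IsSinusoid (f : ℝ → ℝ) : Prop :=
  ∃ a b c : ℝ, ∀ u, f u = a + b * Real.cos u + c * Real.sin u

theorem IsSinusoid.differentiable {f : ℝ → ℝ} (hf : IsSinusoid f) : Differentiable ℝ f := by
  obtain ⟨a, b, c, h⟩ := hf
  rw [funext h]
  fun_prop

/-- The parameter-shift rule `2 * deriv f x = f (x + π / 2) - f (x - π / 2)` turns a bound on a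
sinusoid into a bound on its derivative. -/
theorem IsSinusoid.abs_sub_le {f : ℝ → ℝ} (hf : IsSinusoid f) {B : ℝ} (hB : ∀ u, |f u| ≤ B)
    (u w : ℝ) : |f u - f w| ≤ B * |u - w| := by
  obtain ⟨a, b, c, h⟩ := hf
  have hderiv : ∀ x, HasDerivAt f ((f (x + Real.pi / 2) - f (x - Real.pi / 2)) / 2) x := by
    intro x
    rw [h, h, funext h, Real.cos_add_pi_div_two, Real.sin_add_pi_div_two,
      Real.cos_sub_pi_div_two, Real.sin_sub_pi_div_two]
    convert! (((Real.hasDerivAt_cos x).const_mul b).const_add a).add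
      ((Real.hasDerivAt_sin x).const_mul c) using 1
    ring
  have hbound : ∀ x, ‖(f (x + Real.pi / 2) - f (x - Real.pi / 2)) / 2‖ ≤ B := fun x => by
    rw [Real.norm_eq_abs, abs_div, abs_two, div_le_iff₀ two_pos, mul_two]
    exact (abs_sub _ _).trans (add_le_add (hB _) (hB _))
  exact convex_univ.norm_image_sub_le_of_norm_hasDerivWithin_le
    (fun x _ => (hderiv x).hasDerivWithinAt) (fun x _ => hbound x) (Set.mem_univ w)
    (Set.mem_univ u)

theorem pauliRotation_mul_mul_conjTranspose (P : Pauli) (q : Fin N) (ρ : Op N) (u : ℝ) :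
    pauliRotation P q u * ρ * (pauliRotation P q u)ᴴ
      = (((1 + Real.cos u) / 2 : ℝ) : ℂ) • ρ
        + (((1 - Real.cos u) / 2 : ℝ) : ℂ) • (onQubit q P.toMatrix * ρ * onQubit q P.toMatrix)
        + ((Real.sin u / 2 : ℝ) * Complex.I : ℂ)
          • (ρ * onQubit q P.toMatrix - onQubit q P.toMatrix * ρ) := by
  obtain ⟨φ, rfl⟩ : ∃ φ, u = 2 * φ := ⟨u / 2, by ring⟩
  have hcos : (1 + Real.cos (2 * φ)) / 2 = Real.cos φ * Real.cos φ := by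
    rw [Real.cos_two_mul]; ring
  have hsin : (1 - Real.cos (2 * φ)) / 2 = Real.sin φ * Real.sin φ := by
    rw [Real.cos_two_mul']; linear_combination -Real.sin_sq_add_cos_sq φ / 2
  have hsincos : Real.sin (2 * φ) / 2 = Real.sin φ * Real.cos φ := by
    rw [Real.sin_two_mul]; ring
  rw [conjTranspose_pauliRotation, pauliRotation_eq, pauliRotation_eq, neg_div, Real.cos_neg,
    Real.sin_neg, mul_div_cancel_left₀ φ two_ne_zero, hcos, hsin, hsincos]
  simp only [Complex.ofReal_mul, Complex.ofReal_neg, Matrix.sub_mul, Matrix.mul_sub,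
    Matrix.smul_mul, Matrix.mul_smul, Matrix.one_mul, Matrix.mul_one]
  match_scalars
  all_goals ring_nf
  all_goals simp

theorem isSinusoid_re_trace_pauliRotation (P : Pauli) (q : Fin N) (ρ A : Op N) :
    IsSinusoid fun u => (pauliRotation P q u * ρ * (pauliRotation P q u)ᴴ * A).trace.re := by
  set X := onQubit q P.toMatrix
  refine ⟨((ρ * A).trace.re + (X * ρ * X * A).trace.re) / 2,
    ((ρ * A).trace.re - (X * ρ * X * A).trace.re) / 2,
    (Complex.I * ((ρ * X - X * ρ) * A).trace).re / 2, fun u => ?_⟩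
  dsimp only
  rw [pauliRotation_mul_mul_conjTranspose, Matrix.add_mul, Matrix.add_mul, Matrix.smul_mul,
    Matrix.smul_mul, Matrix.smul_mul, trace_add, trace_add, trace_smul, trace_smul, trace_smul,
    smul_eq_mul, smul_eq_mul, smul_eq_mul, mul_assoc _ Complex.I, Complex.add_re, Complex.add_re,
    Complex.re_ofReal_mul, Complex.re_ofReal_mul, Complex.re_ofReal_mul]
  ring

theorem isSinusoid_circuitExp_update [DecidableEq ι] {gs : List (Gate N ι)} {j : ι}
    (h : (gs.filterMap Gate.coord?).count j = 1) (v : ι → ℝ) (ρ A : Op N) :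
    IsSinusoid fun u => circuitExp (Function.update v j u) gs ρ A := by
  obtain ⟨l₁, l₂, P, q, rfl, h₁, h₂⟩ := exists_eq_append_rotation_cons_of_count_eq_one h
  set V₁ := circuitOp v l₁
  set V₂ := circuitOp v l₂
  have hsplit : ∀ u, circuitExp (Function.update v j u) (l₁ ++ Gate.rotation j P q :: l₂) ρ A
      = (pauliRotation P q u * (V₁ * ρ * V₁ᴴ) * (pauliRotation P q u)ᴴ * (V₂ᴴ * A * V₂)).trace.re :=
    fun u => by
      have hu : circuitOp (Function.update v j u) (l₁ ++ Gate.rotation j P q :: l₂)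
          = V₂ * (pauliRotation P q u * V₁) := by
        rw [circuitOp_append, circuitOp_cons, circuitOp_update_of_notMem h₁,
          circuitOp_update_of_notMem h₂, Gate.toOp, Function.update_self, Matrix.mul_assoc]
      rw [circuitExp, hu, ← Matrix.mul_assoc _ _ V₂, Matrix.trace_mul_comm _ V₂]
      simp only [conjTranspose_mul, Matrix.mul_assoc]
  simp_rw [hsplit]
  exact isSinusoid_re_trace_pauliRotation P q _ _

end Expectation

section Reindex

variable {N : ℕ} {ι κ : Type}

/-- The same gate, with its angle read from the coordinate `f i` instead of `i`. -/
def Gate.reindex (f : ι → κ) : Gate N ι → Gate N κ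
  | .fixed V => .fixed V
  | .rotation i P q => .rotation (f i) P q

theorem Gate.toOp_comp_reindex (f : ι → κ) (v : κ → ℝ) :
    (Gate.toOp v : Gate N κ → Op N) ∘ Gate.reindex f = Gate.toOp (v ∘ f) :=
  funext fun g => by cases g <;> rfl

theorem filterMap_coord?_map_reindex (f : ι → κ) (gs : List (Gate N ι)) :
    (gs.map (Gate.reindex f)).filterMap Gate.coord? = (gs.filterMap Gate.coord?).map f := by
  rw [List.filterMap_map, List.map_filterMap]
  congr 1
  funext g
  cases g <;> rfl

end Reindex

namespace DataReuploadingQNN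

variable {N K D L : ℕ} (Q : DataReuploadingQNN N K D L)

/-- All gates of the circuit, as functions of the joint vector of parameters and features. -/
def circuit : List (Gate N (Fin K ⊕ Fin D)) :=
  (Q.trainable 0).map (Gate.reindex Sum.inl) ++
    (List.ofFn fun l : Fin L => Q.encoding.map (Gate.reindex Sum.inr) ++
      (Q.trainable l.succ).map (Gate.reindex Sum.inl)).flatten

theorem gates_eq_map_circuit (θ : Fin K → ℝ) (x : Fin D → ℝ) :
    Q.gates θ x = Q.circuit.map (Gate.toOp (Sum.elim θ x)) := by
  simp only [gates, circuit, List.map_append, List.map_map, List.map_flatten, List.map_ofFn,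
    Gate.toOp_comp_reindex, Sum.elim_comp_inl]
  congr 3
  funext l
  simp only [Function.comp_apply, List.map_append, List.map_map, Gate.toOp_comp_reindex,
    Sum.elim_comp_inl, Sum.elim_comp_inr]

theorem filterMap_coord?_circuit_perm :
    (Q.circuit.filterMap Gate.coord?).Perm ((List.finRange K).map Sum.inl ++
      (List.finRange L).flatMap fun _ => (List.finRange D).map Sum.inr) := by
  have htrainable := Q.trainable_perm
  rw [List.ofFn_succ, List.flatten_cons, List.ofFn_eq_map, ← List.flatMap_def,
    List.filterMap_append, List.filterMap_flatMap] at htrainable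
  replace htrainable := htrainable.map (Sum.inl : Fin K → Fin K ⊕ Fin D)
  rw [List.map_append, List.map_flatMap] at htrainable
  rw [circuit, List.ofFn_eq_map, ← List.flatMap_def, List.filterMap_append, List.filterMap_flatMap,
    filterMap_coord?_map_reindex]
  simp only [List.filterMap_append, filterMap_coord?_map_reindex]
  refine ((List.flatMap_append_perm _ _ _).symm.append_left _).trans ?_
  refine (List.perm_append_comm.append_left _).trans ?_
  rw [← List.append_assoc]
  exact htrainable.append (List.Perm.flatMap_left _ fun _ _ => Q.encoding_perm.map _)

theorem count_circuit [BEq (Fin K ⊕ Fin D)] [LawfulBEq (Fin K ⊕ Fin D)] (j : Fin K) :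
    (Q.circuit.filterMap Gate.coord?).count (Sum.inl j) = 1 := by
  rw [Q.filterMap_coord?_circuit_perm.count_eq, List.count_append,
    List.count_map_of_injective _ _ Sum.inl_injective,
    List.count_eq_one_of_mem (List.nodup_finRange K) (List.mem_finRange j),
    List.count_eq_zero.2 (by simp)]

theorem le_length_circuit : L * D + K ≤ Q.circuit.length := by
  have h := Q.filterMap_coord?_circuit_perm.length_eq ▸
    List.length_filterMap_le Gate.coord? Q.circuit
  simpa [add_comm] using h

/-- The factor by which the noise damps the signal of the whole circuit. -/
noncomputable def damping (p : ℝ) : ℝ := (1 - p) ^ Q.circuit.length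

theorem damping_mem_Icc {p : ℝ} (hp : p ∈ Set.Icc (0 : ℝ) 1) : Q.damping p ∈ Set.Icc (0 : ℝ) 1 :=
  ⟨pow_nonneg (sub_nonneg.2 hp.2) _, pow_le_one₀ (sub_nonneg.2 hp.2) (sub_le_self _ hp.1)⟩

theorem damping_le {p : ℝ} (hp : p ∈ Set.Icc (0 : ℝ) 1) : Q.damping p ≤ (1 - p) ^ (L * D + K) :=
  pow_le_pow_of_le_one (sub_nonneg.2 hp.2) (sub_le_self _ hp.1) Q.le_length_circuit

theorem output_eq (p : ℝ) (θ : Fin K → ℝ) (x : Fin D → ℝ) :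
    Q.output p θ x = Q.damping p * circuitExp (Sum.elim θ x) Q.circuit Q.ρin Q.obs
      + (1 - Q.damping p) * (Q.obs.trace.re / 2 ^ N) := by
  have hmixed : ((1 - Q.damping p : ℝ) : ℂ) / 2 ^ N = (((1 - Q.damping p) / 2 ^ N : ℝ) : ℂ) := by
    push_cast; rfl
  rw [output, outputState, gates_eq_map_circuit, foldl_depolarize, Q.ρin_trace, Matrix.add_mul,
    Matrix.smul_mul, Matrix.smul_mul, Matrix.one_mul, trace_add, trace_smul, trace_smul,
    Complex.add_re, smul_eq_mul, smul_eq_mul, Complex.re_ofReal_mul, mul_one, ← damping, hmixed,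
    Complex.re_ofReal_mul, circuitExp, mul_div_assoc', div_mul_eq_mul_div]

theorem abs_re_trace_div_le_opNorm (A : Op N) : |A.trace.re / 2 ^ N| ≤ opNorm A := by
  have h := norm_trace_mul_le Matrix.PosSemidef.one A
  have hone : (1 : Op N).trace.re = 2 ^ N := by
    rw [Matrix.trace_one]; norm_cast; simp
  rw [hone, Matrix.one_mul] at h
  rw [abs_div, abs_of_pos (by positivity : (0 : ℝ) < 2 ^ N), div_le_iff₀ (by positivity)]
  exact (Complex.abs_re_le_norm _).trans h

theorem output_mem_Icc {p : ℝ} (hp : p ∈ Set.Icc (0 : ℝ) 1) (θ : Fin K → ℝ) (x : Fin D → ℝ) :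
    Q.output p θ x ∈ Set.Icc (-opNorm Q.obs) (opNorm Q.obs) := by
  obtain ⟨hd0, hd1⟩ := Q.damping_mem_Icc hp
  rw [output_eq]
  exact convex_Icc _ _
    (abs_le.1 (abs_circuitExp_le _ Q.circuit Q.ρin_posSemidef Q.ρin_trace Q.obs))
    (abs_le.1 (abs_re_trace_div_le_opNorm Q.obs)) hd0 (sub_nonneg.2 hd1) (add_sub_cancel _ _)

theorem isSinusoid_circuitExp_circuit_update (θ : Fin K → ℝ) (x : Fin D → ℝ) (j : Fin K) :
    IsSinusoid fun u => circuitExp (Sum.elim (Function.update θ j u) x) Q.circuit Q.ρin Q.obs := by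
  simpa only [Sum.elim_update_left] using
    isSinusoid_circuitExp_update (@count_circuit _ _ _ _ Q instBEqOfDecidableEq _ j) (Sum.elim θ x)
      Q.ρin Q.obs

theorem differentiable_output_update (p : ℝ) (θ : Fin K → ℝ) (x : Fin D → ℝ) (j : Fin K) :
    Differentiable ℝ fun u => Q.output p (Function.update θ j u) x := by
  simp_rw [output_eq]
  exact ((Q.isSinusoid_circuitExp_circuit_update θ x j).differentiable.const_mul _).add_const _

theorem abs_output_update_sub_le {p : ℝ} (hp : p ∈ Set.Icc (0 : ℝ) 1) (θ : Fin K → ℝ)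
    (x : Fin D → ℝ) (j : Fin K) (u w : ℝ) :
    |Q.output p (Function.update θ j u) x - Q.output p (Function.update θ j w) x|
      ≤ (1 - p) ^ (L * D + K) * opNorm Q.obs * |u - w| := by
  have h := (Q.isSinusoid_circuitExp_circuit_update θ x j).abs_sub_le
    (fun u => abs_circuitExp_le _ Q.circuit Q.ρin_posSemidef Q.ρin_trace Q.obs) u w
  rw [output_eq, output_eq, add_sub_add_right_eq_sub, ← mul_sub, abs_mul,
    abs_of_nonneg (Q.damping_mem_Icc hp).1, mul_assoc]
  exact mul_le_mul (Q.damping_le hp) h (abs_nonneg _)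
    ((Q.damping_mem_Icc hp).1.trans (Q.damping_le hp))

theorem continuous_output (p : ℝ) :
    Continuous fun q : (Fin K → ℝ) × (Fin D → ℝ) => Q.output p q.1 q.2 := by
  simp_rw [output_eq]
  have helim : Continuous fun q : (Fin K → ℝ) × (Fin D → ℝ) =>
      (Sum.elim q.1 q.2 : Fin K ⊕ Fin D → ℝ) :=
    continuous_pi fun i => by cases i <;> dsimp only [Sum.elim_inl, Sum.elim_inr] <;> fun_prop
  exact (((continuous_circuitExp Q.circuit Q.ρin Q.obs).comp helim).const_mul _).add_const _

end DataReuploadingQNN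

end NoisyQNN

namespace NoisyQNN

theorem opNorm_nonneg {N : ℕ} (A : Op N) : 0 ≤ opNorm A := norm_nonneg _

/-- The functions `g_T` of the bound. Since the drift of SGD is linear in the learning rate, they
are linear in `b` for every `T`. -/
def growth (C₁ : ℝ) (T : ℕ) (b : ℝ) : ℝ := 4 * C₁ ^ 2 * T ^ 2 * b

theorem isBigOPow_growth (C₁ : ℝ) : IsBigOPow (growth C₁) := by
  refine ⟨fun T a _ b _ hab => mul_le_mul_of_nonneg_left hab (by positivity),
    (4 * C₁ ^ 2 + 1) * 4, by positivity, fun T b hb => ?_⟩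
  have : 0 ≤ b := zero_le_one.trans hb
  rw [growth, abs_of_nonneg (by positivity)]
  rcases T.eq_zero_or_pos with rfl | hT
  · simp
  have hT2 : (T : ℝ) ^ 2 ≤ 4 ^ T := by
    have hT : (T : ℝ) ≤ 2 ^ T := by exact_mod_cast Nat.lt_two_pow_self.le
    calc (T : ℝ) ^ 2 ≤ (2 ^ T) ^ 2 := by gcongr
      _ = 4 ^ T := by rw [← pow_mul, mul_comm, pow_mul]; norm_num
  have hC : 4 * C₁ ^ 2 ≤ (4 * C₁ ^ 2 + 1) ^ T :=
    (le_add_of_nonneg_right zero_le_one).trans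
      (le_self_pow₀ (le_add_of_nonneg_left (by positivity)) hT.ne')
  rw [mul_pow, mul_pow]
  gcongr
  exact le_self_pow₀ hb hT.ne'

theorem four_mul_sq_le_growth (K T : ℕ) {n : ℕ} (hn : 1 ≤ n) {p η B C₁ : ℝ}
    (hp : p ∈ Set.Icc (0 : ℝ) 1) (hη : 0 ≤ η) :
    4 * K * η * (T * (C₁ * ((1 - p) ^ (n + K) * B))) ^ 2
      ≤ (1 - p) ^ n * n * B * growth C₁ T (η * (1 - p) ^ K * K * B) := by
  have hp0 : 0 ≤ 1 - p := sub_nonneg.2 hp.2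
  have hdamp : ((1 - p) ^ (n + K)) ^ 2 ≤ (1 - p) ^ n * n * (1 - p) ^ K := by
    calc ((1 - p) ^ (n + K)) ^ 2 ≤ (1 - p) ^ (n + K) :=
          pow_le_of_le_one (by positivity) (pow_le_one₀ hp0 (sub_le_self _ hp.1)) two_ne_zero
      _ = (1 - p) ^ n * (1 - p) ^ K := pow_add _ _ _
      _ ≤ (1 - p) ^ n * n * (1 - p) ^ K := by
          gcongr
          exact le_mul_of_one_le_right (by positivity) (Nat.one_le_cast.2 hn)
  calc _ = ((1 - p) ^ (n + K)) ^ 2 * (4 * C₁ ^ 2 * T ^ 2 * (η * K * B ^ 2)) := by ring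
    _ ≤ (1 - p) ^ n * n * (1 - p) ^ K * (4 * C₁ ^ 2 * T ^ 2 * (η * K * B ^ 2)) := by gcongr
    _ = _ := by rw [growth]; ring

theorem stability_bound_le_growth_bound {K D L m T : ℕ} (hD : 1 ≤ D) (hL : 1 ≤ L)
    {p η B C₁ M r : ℝ} (hp : p ∈ Set.Icc (0 : ℝ) 1) (hη : 0 ≤ η) :
    2 * K * η * (T * (C₁ * ((1 - p) ^ (L * D + K) * B))) ^ 2 / m
        + (4 * K * η * (T * (C₁ * ((1 - p) ^ (L * D + K) * B))) ^ 2 + M) * √r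
      ≤ (1 - p) ^ (L * D) * (L * D) * B / m * growth C₁ T (η * (1 - p) ^ K * K * B)
        + ((1 - p) ^ (L * D) * (L * D) * B * growth C₁ T (η * (1 - p) ^ K * K * B) + M) * √r := by
  have hgrowth := four_mul_sq_le_growth (B := B) (C₁ := C₁) K T (Nat.mul_pos hL hD) hp hη
  push_cast at hgrowth
  have hhalf : 2 * K * η * (T * (C₁ * ((1 - p) ^ (L * D + K) * B))) ^ 2
      ≤ 4 * K * η * (T * (C₁ * ((1 - p) ^ (L * D + K) * B))) ^ 2 := by
    gcongr
    norm_num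
  rw [div_mul_eq_mul_div]
  exact add_le_add (div_le_div_of_nonneg_right (hhalf.trans hgrowth) m.cast_nonneg)
    (mul_le_mul_of_nonneg_right (add_le_add_left hgrowth M) (Real.sqrt_nonneg _))

namespace DataReuploadingQNN

variable {N K D L : ℕ} (Q : DataReuploadingQNN N K D L)

theorem measurable_loss_output (p : ℝ) {ℓ : ℝ → ℝ → ℝ} (hℓ : Measurable (Function.uncurry ℓ)) :
    Measurable (Function.uncurry fun (z : (Fin D → ℝ) × ℝ) θ => ℓ (Q.output p θ z.1) z.2) :=
  hℓ.comp (((Q.continuous_output p).measurable.comp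
    (measurable_snd.prodMk measurable_fst.fst)).prodMk measurable_fst.snd)

theorem differentiableAt_loss_output_update {p : ℝ} (hp : p ∈ Set.Icc (0 : ℝ) 1) {φ : ℝ → ℝ}
    (hφ : ∀ a ∈ Set.Icc (-opNorm Q.obs) (opNorm Q.obs), DifferentiableAt ℝ φ a)
    (x : Fin D → ℝ) (θ : Fin K → ℝ) (j : Fin K) :
    DifferentiableAt ℝ (fun u => φ (Q.output p (Function.update θ j u) x)) (θ j) :=
  (hφ _ (Q.output_mem_Icc hp _ x)).comp (θ j) (Q.differentiable_output_update p θ x j (θ j))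

theorem abs_loss_output_update_sub_le {p : ℝ} (hp : p ∈ Set.Icc (0 : ℝ) 1) {φ : ℝ → ℝ} {C : ℝ}
    (hC : 0 ≤ C) (hφ : ∀ a ∈ Set.Icc (-opNorm Q.obs) (opNorm Q.obs),
      ∀ b ∈ Set.Icc (-opNorm Q.obs) (opNorm Q.obs), |φ a - φ b| ≤ C * |a - b|)
    (x : Fin D → ℝ) (θ : Fin K → ℝ) (j : Fin K) (u w : ℝ) :
    |φ (Q.output p (Function.update θ j u) x) - φ (Q.output p (Function.update θ j w) x)|
      ≤ C * ((1 - p) ^ (L * D + K) * opNorm Q.obs) * |u - w| := by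
  rw [mul_assoc]
  exact (hφ _ (Q.output_mem_Icc hp _ x) _ (Q.output_mem_Icc hp _ x)).trans
    (mul_le_mul_of_nonneg_left (Q.abs_output_update_sub_le hp θ x j u w) hC)

theorem expectedGap_eq {m : ℕ} (p : ℝ) (ℓ : ℝ → ℝ → ℝ) (η : ℝ) (T : ℕ) (ν : Measure (Fin K → ℝ))
    (𝔻 : Measure ((Fin D → ℝ) × ℝ)) (S : Fin m → (Fin D → ℝ) × ℝ) :
    Q.expectedGap p ℓ η T ν 𝔻 S = ∫ θ₀, (∑ ω : Fin T → Fin m, generalizationGap 𝔻 (fun S z =>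
      ℓ (Q.output p (sgdIterate (fun z θ => ℓ (Q.output p θ z.1) z.2) η S ω θ₀) z.1) z.2) S)
        / (m : ℝ) ^ T ∂ν :=
  rfl

end DataReuploadingQNN

end NoisyQNN

theorem mainTheorem6_general {N K D L m T : ℕ} (hm : 1 ≤ m)
    (Q : NoisyQNN.DataReuploadingQNN N K D L) {p : ℝ} (hp : p ∈ Set.Icc (0 : ℝ) 1) {η : ℝ}
    (hη : 0 ≤ η) {𝒴 : Set ℝ} {ℓ : ℝ → ℝ → ℝ} (hℓ : Measurable (Function.uncurry ℓ)) {C₁ : ℝ}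
    (hC₁ : 0 ≤ C₁)
    (hlip : ∀ y ∈ 𝒴, ∀ a ∈ Set.Icc (-NoisyQNN.opNorm Q.obs) (NoisyQNN.opNorm Q.obs),
      ∀ b ∈ Set.Icc (-NoisyQNN.opNorm Q.obs) (NoisyQNN.opNorm Q.obs),
        |ℓ a y - ℓ b y| ≤ C₁ * |a - b|)
    (hdiff : ∀ y ∈ 𝒴, ∀ a ∈ Set.Icc (-NoisyQNN.opNorm Q.obs) (NoisyQNN.opNorm Q.obs),
      DifferentiableAt ℝ (fun u => ℓ u y) a)
    {M : ℝ}
    (hM : ∀ y ∈ 𝒴, ∀ a ∈ Set.Icc (-NoisyQNN.opNorm Q.obs) (NoisyQNN.opNorm Q.obs),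
      0 ≤ ℓ a y ∧ ℓ a y ≤ M)
    {𝔻 : Measure ((Fin D → ℝ) × ℝ)} [IsProbabilityMeasure 𝔻] (h𝒴 : ∀ᵐ z ∂𝔻, z.2 ∈ 𝒴)
    (ν : Measure (Fin K → ℝ)) [IsProbabilityMeasure ν] {δ : ℝ} (hδ : δ ∈ Set.Ioo (0 : ℝ) 1) :
    ENNReal.ofReal (1 - δ) ≤ Measure.pi (fun _ : Fin m => 𝔻)
      {S | Q.expectedGap p ℓ η T ν 𝔻 S ≤
        2 * K * η * (T * (C₁ * ((1 - p) ^ (L * D + K) * NoisyQNN.opNorm Q.obs))) ^ 2 / m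
          + (4 * K * η * (T * (C₁ * ((1 - p) ^ (L * D + K) * NoisyQNN.opNorm Q.obs))) ^ 2 + M)
            * √(Real.log (1 / δ) / (2 * m))} := by
  have : NeZero m := ⟨Nat.one_le_iff_ne_zero.1 hm⟩
  obtain ⟨z₀, hz₀⟩ := h𝒴.exists
  have hM0 : 0 ≤ M := by
    obtain ⟨h₀, hM⟩ := hM _ hz₀ _ (Q.output_mem_Icc hp 0 z₀.1)
    exact h₀.trans hM
  have hκ : 0 ≤ C₁ * ((1 - p) ^ (L * D + K) * NoisyQNN.opNorm Q.obs) :=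
    mul_nonneg hC₁ (mul_nonneg (pow_nonneg (sub_nonneg.2 hp.2) _) (NoisyQNN.opNorm_nonneg _))
  lift M to ℝ≥0 using hM0
  lift η to ℝ≥0 using hη
  have hbound := measure_integral_sum_generalizationGap_le (m := m) (ν := ν) (η := η) (κ := ⟨_, hκ⟩)
    h𝒴 (Q.measurable_loss_output p hℓ)
    (fun z hz θ j => Q.differentiableAt_loss_output_update hp (hdiff _ hz) z.1 θ j)
    (fun z hz θ => hM _ hz _ (Q.output_mem_Icc hp θ z.1))
    (fun z hz θ j => LipschitzWith.of_dist_le_mul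
      (Q.abs_loss_output_update_sub_le hp hC₁ (hlip _ hz) z.1 θ j)) T hδ
  rw [Fintype.card_fin] at hbound
  simp only [Q.expectedGap_eq]
  exact hbound

theorem mainTheorem6 (C₁ C₂ : ℝ) (hC₁ : 0 ≤ C₁) (hC₂ : 0 ≤ C₂) :
    ∃ g : ℕ → ℝ → ℝ, NoisyQNN.IsBigOPow g ∧
      ∀ (N K D L m T : ℕ) (_hD : 1 ≤ D) (_hL : 1 ≤ L) (_hm : 1 ≤ m)
        (Q : NoisyQNN.DataReuploadingQNN N K D L)
        (p : ℝ) (_hp : p ∈ Set.Icc (0 : ℝ) 1) (η : ℝ) (_hη : 0 < η)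
        (𝒴 : Set ℝ) (ℓ : ℝ → ℝ → ℝ) (_hℓ : Measurable (Function.uncurry ℓ))
        (_hℓs : NoisyQNN.IsLipschitzSmooth ℓ 𝒴 (NoisyQNN.opNorm Q.obs) C₁ C₂)
        (M : ℝ)
        (_hM : ∀ y ∈ 𝒴, ∀ a ∈ Set.Icc (-NoisyQNN.opNorm Q.obs) (NoisyQNN.opNorm Q.obs),
          0 ≤ ℓ a y ∧ ℓ a y ≤ M)
        (𝔻 : MeasureTheory.Measure ((Fin D → ℝ) × ℝ)) (_h𝔻 : MeasureTheory.IsProbabilityMeasure 𝔻)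
        (_h𝒴 : ∀ᵐ z ∂𝔻, z.2 ∈ 𝒴)
        (ν : MeasureTheory.Measure (Fin K → ℝ)) (_hν : MeasureTheory.IsProbabilityMeasure ν)
        (δ : ℝ) (_hδ : δ ∈ Set.Ioo (0 : ℝ) 1),
        ENNReal.ofReal (1 - δ) ≤
          MeasureTheory.Measure.pi (fun _ : Fin m => 𝔻)
            {S | Q.expectedGap p ℓ η T ν 𝔻 S ≤
              (1 - p) ^ (L * D) * (L * D) * NoisyQNN.opNorm Q.obs / m
                  * g T (η * (1 - p) ^ K * K * NoisyQNN.opNorm Q.obs)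
                + ((1 - p) ^ (L * D) * (L * D) * NoisyQNN.opNorm Q.obs
                    * g T (η * (1 - p) ^ K * K * NoisyQNN.opNorm Q.obs) + M)
                  * Real.sqrt (Real.log (1 / δ) / (2 * m))} := by
  refine ⟨NoisyQNN.growth C₁, NoisyQNN.isBigOPow_growth C₁, ?_⟩
  intro N K D L m T hD hL hm Q p hp η hη 𝒴 ℓ hℓ hℓs M hM 𝔻 h𝔻 h𝒴 ν hν δ hδ
  exact (mainTheorem6_general hm Q hp hη.le hℓ hC₁ hℓs.lipschitz hℓs.differentiable hM h𝒴 ν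
    hδ).trans (measure_mono (Set.ofPred_subset_ofPred.2 fun S hS =>
      hS.trans (NoisyQNN.stability_bound_le_growth_bound hD hL hp hη.le)))
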